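/- Let $\Sigma$ be a smooth oriented three-manifold. Families of tensors $\{\cdot_t\}_{t\in\mathbb{R}}$ on $\Sigma$ are smooth, i.e. smooth sections over $\mathbb{R}\times\Sigma$ of the pull-back of the corresponding tensor bundle of $\Sigma$. For a family of Riemannian metrics $h_t$ and a family of nowhere vanishing functions $\lambda_t$ on $\Sigma$ put $\Theta_t=-\frac{1}{2\lambda_t}\partial_t h_t$ and, for a one-form $\alpha$, $\Theta_t(\alpha)=\Theta_t(\alpha^{\sharp_{h_t}},\cdot)$ and $\mathrm{d}\lambda_t(\alpha)=\mathrm{d}\lambda_t(\alpha^{\sharp_{h_t}})$. A \emph{parallel spinor flow} on $\mathbb{R}\times\Sigma$ is a tuple of families $(\lambda_t,h_t,u^0_t,u^\perp_t,l^\perp_t)$ of nowhere vanishing functions $\lambda_t$, Riemannian metrics $h_t$, nowhere vanishing functions $u^0_t$ and one-forms $u^\perp_t$, $l^\perp_t$ on $\Sigma$ with $$\partial_t u^\perp_t+\lambda_t\Theta_t(u^\perp_t)=u^0_t\,\mathrm{d}\lambda_t,\qquad u^0_t\partial_t l^\perp_t+\lambda_t u^0_t\Theta_t(l^\perp_t)+\mathrm{d}\lambda_t(l^\perp_t)\,u^\perp_t=0,$$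 $$\nabla^{h_t}u^\perp_t+u^0_t\Theta_t=0,\qquad u^0_t\nabla^{h_t}l^\perp_t=\Theta_t(l^\perp_t)\otimes u^\perp_t,$$ $$(u^0_t)^2=|u^\perp_t|^2_{h_t},\qquad |l^\perp_t|^2_{h_t}=1,\qquad h_t(u^\perp_t,l^\perp_t)=0.$$ It is \emph{comoving} if $\lambda_t=1$ for all $t$. We say that $(\mathbb{R}\times\Sigma,g)$ admits a comoving parallel spinor flow if there is one with $g=-\mathrm{d}t\otimes\mathrm{d}t+h_t$. For a family of coframes $\mathfrak{e}^t=(e^t_u,e^t_l,e^t_n)$ write $h_{\mathfrak{e}^t}=e^t_u\otimes e^t_u+e^t_l\otimes e^t_l+e^t_n\otimes e^t_n$ and now $\Theta_t=-\frac12\partial_t h_{\mathfrak{e}^t}$, with metric duals taken in $h_{\mathfrak{e}^t}$, and consider the system $$\partial_t\mathfrak{e}^t+\Theta_t(\mathfrak{e}^t)=0,\quad \mathrm{d}\mathfrak{e}^t=\Theta_t(\mathfrak{e}^t)\wedge e^t_u,\quad [\Theta_t(e^t_u)]=0\in H^1(\Sigma,\mathbb{R}),\quad \partial_t\big(\Theta_t(e^t_u)\big)=0,\qquad(\ast)$$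 for all $t\in\mathbb{R}$, where the first two equations hold for each of $e^t_u,e^t_l,e^t_n$. \textbf{Theorem.} For every field $g$ of bilinear forms on the tangent spaces of $\mathbb{R}\times\Sigma$, $(\mathbb{R}\times\Sigma,g)$ admits a comoving parallel spinor flow if and only if $\Sigma$ admits a family $\{\mathfrak{e}^t\}_{t\in\mathbb{R}}$ of oriented coframes satisfying $(\ast)$ with $$g=-\mathrm{d}t\otimes\mathrm{d}t+h_{\mathfrak{e}^t}.$$ Moreover $(\mathbb{R}\times\Sigma,g)$ admits a comoving parallel spinor flow and $g$ is comoving globally hyperbolic (that is, $g=-\mathrm{d}t\otimes\mathrm{d}t+h_t$ for a family of complete Riemannian metrics $h_t$) if and only if there is such a family $\{\mathfrak{e}^t\}$ for which all $h_{\mathfrak{e}^t}$ are complete. More precisely, for every comoving parallel spinor flow there is a unique family of oriented coframes $\mathfrak{e}^t$ with $h_{\mathfrak{e}^t}=h_t$, $u^0_te^t_u=u^\perp_t$ and $e^t_l=l^\perp_t$, and it satisfies $(\ast)$; and every family of oriented coframes satisfying $(\ast)$ arises in this way from a comoving parallel spinor flow. -/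

import Mathlib

open Bundle Filter Topology Manifold
open scoped ContDiff ENNReal

noncomputable section

namespace ComovingSpinor

/-- The model space of three-manifolds. -/
abbrev E3 : Type := EuclideanSpace ℝ (Fin 3)

section Fields

variable (S : Type*) [TopologicalSpace S] [ChartedSpace E3 S]

/-- Fields of covectors on `S` (no smoothness). -/
abbrev OneFormField : Type _ := ∀ x : S, TangentSpace (𝓡 3) x →L[ℝ] ℝ

/-- Fields of bilinear forms on the tangent spaces of `S` (no smoothness). -/
abbrev BilinField : Type _ :=
  ∀ x : S, TangentSpace (𝓡 3) x →L[ℝ] TangentSpace (𝓡 3) x →L[ℝ] ℝ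

variable [IsManifold (𝓡 3) ∞ S]

/-- An orientation of `S`: an orientation of every tangent space which, read in the trivialization
of the tangent bundle given by the preferred chart at `x₀`, is constant near `x₀`. -/
structure ManifoldOrientation where
  at' : ∀ x : S, Orientation ℝ (TangentSpace (𝓡 3) x) (Fin 3)
  locally_constant : ∀ x₀ : S, ∀ᶠ y in 𝓝 x₀,
    ∀ hy : y ∈ (trivializationAt E3 (TangentSpace (𝓡 3)) x₀).baseSet,
      Orientation.map (Fin 3)
        ((trivializationAt E3 (TangentSpace (𝓡 3)) x₀).continuousLinearEquivAt ℝ y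
          hy).toLinearEquiv (at' y) =
      Orientation.map (Fin 3)
        ((trivializationAt E3 (TangentSpace (𝓡 3)) x₀).continuousLinearEquivAt ℝ x₀
          (mem_baseSet_trivializationAt E3 (TangentSpace (𝓡 3)) x₀)).toLinearEquiv (at' x₀)

end Fields

section Tensors

variable {S : Type*} [TopologicalSpace S] [ChartedSpace E3 S]

/-- A smooth family of functions, that is, a smooth function on `ℝ × S`. -/
def SmoothFunctionFamily (f : ℝ → S → ℝ) : Prop :=
  ContMDiff (𝓘(ℝ, ℝ).prod (𝓡 3)) 𝓘(ℝ, ℝ) ∞ (fun p : ℝ × S => f p.1 p.2)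

/-- A smooth family of one-forms: a smooth section over `ℝ × S` of the pull-back of `T*S`. -/
def SmoothOneFormFamily [IsManifold (𝓡 3) ∞ S] (α : ℝ → OneFormField S) : Prop :=
  ContMDiff (𝓘(ℝ, ℝ).prod (𝓡 3)) ((𝓡 3).prod 𝓘(ℝ, E3 →L[ℝ] ℝ)) ∞
    (fun p : ℝ × S => TotalSpace.mk' (E3 →L[ℝ] ℝ)
      (E := fun x : S => TangentSpace (𝓡 3) x →L[ℝ] Bundle.Trivial S ℝ x) p.2 (α p.1 p.2))

/-- A smooth family of bilinear forms: a smooth section over `ℝ × S` of the pull-back of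
`T*S ⊗ T*S`. -/
def SmoothBilinFamily [IsManifold (𝓡 3) ∞ S] (h : ℝ → BilinField S) : Prop :=
  ContMDiff (𝓘(ℝ, ℝ).prod (𝓡 3)) ((𝓡 3).prod 𝓘(ℝ, E3 →L[ℝ] E3 →L[ℝ] ℝ)) ∞
    (fun p : ℝ × S => TotalSpace.mk' (E3 →L[ℝ] E3 →L[ℝ] ℝ)
      (E := fun x : S =>
        TangentSpace (𝓡 3) x →L[ℝ] TangentSpace (𝓡 3) x →L[ℝ] Bundle.Trivial S ℝ x)
      p.2 (h p.1 p.2))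

/-- Symmetric and positive definite at every point. -/
structure IsRiemannian (h : BilinField S) : Prop where
  symm : ∀ x v w, h x v w = h x w v
  pos : ∀ x v, v ≠ 0 → 0 < h x v v

open Classical in
/-- The metric dual `α♯` of the covector `α`: the vector with `h (α♯) w = α w` for all `w`.
It exists and is unique for a positive definite `h` on a finite-dimensional space; the default
value is never used for such `h`. -/
def sharp {V : Type*} [AddCommGroup V] [Module ℝ V] [TopologicalSpace V]
    [IsTopologicalAddGroup V] [ContinuousConstSMul ℝ V]
    (h : V →L[ℝ] V →L[ℝ] ℝ) (α : V →L[ℝ] ℝ) : V :=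
  if H : ∃ a : V, ∀ w : V, h a w = α w then H.choose else 0

/-- The inner product `h(α, β)` of two one-forms at `x`. -/
def formInner (h : BilinField S) (α β : OneFormField S) (x : S) : ℝ :=
  α x (sharp (h x) (β x))

/-! ### Differential operators, computed in the preferred chart at the point -/

/-- The components of a tangent vector at `x` in the preferred chart `φ` at `x`. -/
def coordVec (x : S) (v : TangentSpace (𝓡 3) x) : E3 :=
  mfderiv (𝓡 3) 𝓘(ℝ, E3) (extChartAt (𝓡 3) x) x v

/-- `(φ⁻¹)^* α`, where `φ` is the preferred chart at `x`. -/
def formInChart (α : OneFormField S) (x : S) (z : E3) (a : E3) : ℝ :=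
  α ((extChartAt (𝓡 3) x).symm z)
    (mfderiv 𝓘(ℝ, E3) (𝓡 3) (extChartAt (𝓡 3) x).symm z a)

/-- `(φ⁻¹)^* h`, where `φ` is the preferred chart at `x`. -/
def bilinInChart (h : BilinField S) (x : S) (z : E3) (a b : E3) : ℝ :=
  h ((extChartAt (𝓡 3) x).symm z)
    (mfderiv 𝓘(ℝ, E3) (𝓡 3) (extChartAt (𝓡 3) x).symm z a)
    (mfderiv 𝓘(ℝ, E3) (𝓡 3) (extChartAt (𝓡 3) x).symm z b)

/-- The exterior derivative of a one-form: `(dα)_{ij} = ∂_i α_j - ∂_j α_i`. -/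
def extDerivOneForm (α : OneFormField S) (x : S) (v w : TangentSpace (𝓡 3) x) : ℝ :=
  fderiv ℝ (fun z => formInChart α x z (coordVec x w)) (extChartAt (𝓡 3) x x) (coordVec x v) -
  fderiv ℝ (fun z => formInChart α x z (coordVec x v)) (extChartAt (𝓡 3) x x) (coordVec x w)

/-- The Christoffel symbols of the first kind of the metric `h` in the preferred chart at `x`:
`Γ_{kij} = ½ (∂_i h_{jk} + ∂_j h_{ik} - ∂_k h_{ij})`, contracted with the vectors `c, a, b`. -/
def christoffel (h : BilinField S) (x : S) (c a b : E3) : ℝ :=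
  (1 / 2) *
    (fderiv ℝ (fun z => bilinInChart h x z b c) (extChartAt (𝓡 3) x x) a +
     fderiv ℝ (fun z => bilinInChart h x z a c) (extChartAt (𝓡 3) x x) b -
     fderiv ℝ (fun z => bilinInChart h x z a b) (extChartAt (𝓡 3) x x) c)

/-- The Levi-Civita covariant derivative of a one-form, `(∇ʰα)(v, w) = (∇ʰ_v α)(w)`:
`∇_i α_j = ∂_i α_j - Γ^k_{ij} α_k = ∂_i α_j - Γ_{kij} (α♯)^k`. -/
def covDeriv (h : BilinField S) (α : OneFormField S) (x : S)
    (v w : TangentSpace (𝓡 3) x) : ℝ :=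
  fderiv ℝ (fun z => formInChart α x z (coordVec x w)) (extChartAt (𝓡 3) x x) (coordVec x v) -
  christoffel h x (coordVec x (sharp (h x) (α x))) (coordVec x v) (coordVec x w)

/-! ### The second fundamental form -/

/-- `Θ_t = - (1 / (2 λ_t)) ∂_t h_t`. -/
def shape (lapse : ℝ → S → ℝ) (h : ℝ → BilinField S) (t : ℝ) (x : S)
    (v w : TangentSpace (𝓡 3) x) : ℝ :=
  -(1 / (2 * lapse t x)) * deriv (fun s => h s x v w) t

/-- The one-form `Θ_t(α) = Θ_t(α♯, ·)`, with `♯` taken with respect to `h_t`. -/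
def shapeForm (lapse : ℝ → S → ℝ) (h : ℝ → BilinField S) (t : ℝ) (α : OneFormField S) (x : S)
    (w : TangentSpace (𝓡 3) x) : ℝ :=
  shape lapse h t x (sharp (h t x) (α x)) w

/-! ### Metrics on `ℝ × S` -/

/-- Fields of bilinear forms on the tangent spaces of the four-manifold `ℝ × S`. -/
abbrev SpacetimeBilinField (S : Type*) [TopologicalSpace S] [ChartedSpace E3 S] : Type _ :=
  ∀ p : ℝ × S, TangentSpace (𝓘(ℝ, ℝ).prod (𝓡 3)) p →L[ℝ]
    TangentSpace (𝓘(ℝ, ℝ).prod (𝓡 3)) p →L[ℝ] ℝ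

/-- `g = - λ_t² dt ⊗ dt + h_t` on `ℝ × S`. -/
def IsStandardMetric (g : SpacetimeBilinField S) (lapse : ℝ → S → ℝ) (h : ℝ → BilinField S) :
    Prop :=
  ∀ (p : ℝ × S) (V W : TangentSpace (𝓘(ℝ, ℝ).prod (𝓡 3)) p),
    g p V W =
      -(lapse p.1 p.2) ^ 2 *
        (mvfderiv (𝓘(ℝ, ℝ).prod (𝓡 3)) (Prod.fst : ℝ × S → ℝ) p V *
          mvfderiv (𝓘(ℝ, ℝ).prod (𝓡 3)) (Prod.fst : ℝ × S → ℝ) p W) +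
      h p.1 p.2 (mfderiv (𝓘(ℝ, ℝ).prod (𝓡 3)) (𝓡 3) (Prod.snd : ℝ × S → S) p V)
        (mfderiv (𝓘(ℝ, ℝ).prod (𝓡 3)) (𝓡 3) (Prod.snd : ℝ × S → S) p W)

/-- The Riemannian distance of `h`: the infimum of the `h`-lengths of `C^1` paths. -/
def riemDist (h : BilinField S) (x y : S) : ℝ≥0∞ :=
  letI : ∀ z : S, ENorm (TangentSpace (𝓡 3) z) :=
    fun z => ⟨fun v => ENNReal.ofReal (Real.sqrt (h z v v))⟩
  riemannianEDist (𝓡 3) x y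

/-- Completeness of a Riemannian metric: Cauchy sequences for its distance converge. -/
def IsCompleteMetric (h : BilinField S) : Prop :=
  ∀ a : ℕ → S, (∀ ε : ℝ≥0∞, 0 < ε → ∃ N, ∀ m ≥ N, ∀ n ≥ N, riemDist h (a m) (a n) < ε) →
    ∃ x, Tendsto a atTop (𝓝 x)

end Tensors

section Flows

variable {S : Type*} [TopologicalSpace S] [ChartedSpace E3 S] [IsManifold (𝓡 3) ∞ S]

/-- `g = - dt ⊗ dt + h_t` on `ℝ × S` for a smooth family of complete Riemannian metrics `h_t`. -/
def IsComovingGloballyHyperbolic (g : SpacetimeBilinField S) : Prop :=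
  ∃ h : ℝ → BilinField S, SmoothBilinFamily h ∧ (∀ t, IsRiemannian (h t)) ∧
    (∀ t, IsCompleteMetric (h t)) ∧ IsStandardMetric g (fun _ _ => 1) h

variable (S) in
/-- A parallel spinor flow on `ℝ × S`: smooth families `λ_t`, `h_t`, `u⁰_t`, `u^⊥_t`, `l^⊥_t` such
that `u = u⁰_t λ_t dt + u^⊥_t` is a nowhere vanishing null one-form (equivalently `u⁰` has no zero
and `(u⁰)² = |u^⊥|²`), `l^⊥` is a unit one-form orthogonal to `u^⊥`, and the evolution and
constraint equations hold. -/
structure ParallelSpinorFlow where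
  lapse : ℝ → S → ℝ
  h : ℝ → BilinField S
  u0 : ℝ → S → ℝ
  u : ℝ → OneFormField S
  l : ℝ → OneFormField S
  smooth_lapse : SmoothFunctionFamily lapse
  smooth_h : SmoothBilinFamily h
  smooth_u0 : SmoothFunctionFamily u0
  smooth_u : SmoothOneFormFamily u
  smooth_l : SmoothOneFormFamily l
  lapse_ne_zero : ∀ t x, lapse t x ≠ 0
  riemannian : ∀ t, IsRiemannian (h t)
  u0_ne_zero : ∀ t x, u0 t x ≠ 0
  /-- `∂_t u^⊥ + λ Θ(u^⊥) = u⁰ dλ`. -/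
  evolution_u : ∀ t x (v : TangentSpace (𝓡 3) x),
    deriv (fun s => u s x v) t + lapse t x * shapeForm lapse h t (u t) x v =
      u0 t x * mvfderiv (𝓡 3) (lapse t) x v
  /-- `u⁰ ∂_t l^⊥ + λ u⁰ Θ(l^⊥) + dλ(l^⊥) u^⊥ = 0`. -/
  evolution_l : ∀ t x (v : TangentSpace (𝓡 3) x),
    u0 t x * deriv (fun s => l s x v) t +
      lapse t x * u0 t x * shapeForm lapse h t (l t) x v +
      mvfderiv (𝓡 3) (lapse t) x (sharp (h t x) (l t x)) * u t x v = 0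
  /-- `∇ u^⊥ + u⁰ Θ = 0`. -/
  constraint_u : ∀ t x (v w : TangentSpace (𝓡 3) x),
    covDeriv (h t) (u t) x v w + u0 t x * shape lapse h t x v w = 0
  /-- `u⁰ ∇ l^⊥ = Θ(l^⊥) ⊗ u^⊥`. -/
  constraint_l : ∀ t x (v w : TangentSpace (𝓡 3) x),
    u0 t x * covDeriv (h t) (l t) x v w = shapeForm lapse h t (l t) x v * u t x w
  norm_u : ∀ t x, (u0 t x) ^ 2 = formInner (h t) (u t) (u t) x
  norm_l : ∀ t x, formInner (h t) (l t) (l t) x = 1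
  orthogonal : ∀ t x, formInner (h t) (u t) (l t) x = 0

/-- The flow is comoving if `λ_t = 1` for all `t`. -/
def ParallelSpinorFlow.IsComoving (F : ParallelSpinorFlow S) : Prop :=
  ∀ t x, F.lapse t x = 1

/-- `(ℝ × S, g)` admits a comoving parallel spinor flow: there is one whose space-time metric
`- λ_t² dt ⊗ dt + h_t` is `g`. -/
def AdmitsComovingParallelSpinorFlow (g : SpacetimeBilinField S) : Prop :=
  ∃ F : ParallelSpinorFlow S, F.IsComoving ∧ IsStandardMetric g F.lapse F.h

/-- A smooth family of oriented coframes `e^t = (e_u, e_l, e_n) = (e 0, e 1, e 2)` on `S`, that is,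
of sections of the bundle of oriented coframes: `e_u ∧ e_l ∧ e_n` is positive on the positively
oriented bases of the tangent spaces. -/
structure IsOrientedCoframeFamily (o : ManifoldOrientation S)
    (e : Fin 3 → ℝ → OneFormField S) : Prop where
  smooth : ∀ i, SmoothOneFormFamily (e i)
  oriented : ∀ t x (b : Module.Basis (Fin 3) ℝ (TangentSpace (𝓡 3) x)),
    b.orientation = o.at' x → 0 < (Matrix.of fun i j => e i t x (b j)).det

/-- `h_{e^t} = e_u ⊗ e_u + e_l ⊗ e_l + e_n ⊗ e_n`. -/
def coframeMetric (e : Fin 3 → ℝ → OneFormField S) (t : ℝ) : BilinField S :=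
  fun x => ∑ i, (e i t x).smulRight (e i t x)

/-- `Θ_t(α)` for `Θ_t = - ½ ∂_t h_{e^t}`. -/
def coframeShapeForm (e : Fin 3 → ℝ → OneFormField S) (t : ℝ) (α : OneFormField S) (x : S)
    (w : TangentSpace (𝓡 3) x) : ℝ :=
  shapeForm (fun _ _ => 1) (coframeMetric e) t α x w

/-- The comoving parallel spinor flow equations for a family of coframes. -/
structure ComovingFlowEquations (e : Fin 3 → ℝ → OneFormField S) : Prop where
  /-- `∂_t e^t + Θ_t(e^t) = 0`. -/
  evolution : ∀ i t x (v : TangentSpace (𝓡 3) x),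
    deriv (fun s => e i s x v) t + coframeShapeForm e t (e i t) x v = 0
  /-- `d e^t = Θ_t(e^t) ∧ e_u^t`. -/
  structure_eq : ∀ i t x (v w : TangentSpace (𝓡 3) x),
    extDerivOneForm (e i t) x v w =
      coframeShapeForm e t (e i t) x v * e 0 t x w - coframeShapeForm e t (e i t) x w * e 0 t x v
  /-- `[Θ_t(e_u^t)] = 0` in de Rham cohomology, that is, `Θ_t(e_u^t)` is exact. -/
  exact : ∀ t, ∃ f : S → ℝ, ContMDiff (𝓡 3) 𝓘(ℝ, ℝ) ∞ f ∧
    ∀ x (v : TangentSpace (𝓡 3) x), mvfderiv (𝓡 3) f x v = coframeShapeForm e t (e 0 t) x v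
  /-- `∂_t (Θ_t(e_u^t)) = 0`. -/
  stationary : ∀ t x (v : TangentSpace (𝓡 3) x),
    deriv (fun s => coframeShapeForm e s (e 0 s) x v) t = 0

/-- The coframes `e^t` are orthonormal for `h_t`, with `u^⊥ = u⁰ e_u` and `l^⊥ = e_l`. -/
structure IsAdapted (F : ParallelSpinorFlow S) (e : Fin 3 → ℝ → OneFormField S) : Prop where
  metric : ∀ t, F.h t = coframeMetric e t
  u_eq : ∀ t x, F.u t x = F.u0 t x • e 0 t x
  l_eq : ∀ t x, F.l t x = e 1 t x

end Flows

end ComovingSpinor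

end

/-!
Along a comoving flow write `u = u⁰ e_u` and `l = e_l`. The flow equations say that the evolution
defect `∂_t e + Θ(e)` and, direction by direction, the structure defect `∇e - Θ(e) ⊗ e_u`, with `Θ`
added for `e = e_u`, vanish on `e_l` and are multiples of `e_u` on `e_u`. Since `∂_t h = -2Θ` and
`∇h = 0`, both defects are skew with respect to `h`, and a skew defect of this shape vanishes on all
three covectors. What is left of the equations is `d log u⁰ = -Θ(e_u)` and `∂_t u⁰ = 0`, which makes
`Θ(e_u)` exact and constant in time.

Conversely, if `f` is a potential of the time-independent form `Θ(e_u)`, then `u⁰ = exp (-f)`,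
`u = u⁰ e_u`, `l = e_l` is a comoving flow: the structure defect is now symmetric in its two vector
arguments by `de = Θ(e) ∧ e_u` and skew by `∇h = 0`, hence zero as in the uniqueness of the
Levi-Civita connection.

The third covector is recovered from the metric, the orientation and the other two by Cramer's rule,
which gives both its smoothness and its uniqueness.
-/

noncomputable section

namespace ComovingSpinor

section LinearAlgebra

open scoped Matrix

theorem eq_zero_of_symm_of_skew {V R : Type*} [AddCommGroup R] [IsAddTorsionFree R]
    {T : V → V → V → R} (hsymm : ∀ u v w, T u v w = T v u w) (hskew : ∀ u v w, T u v w = -T u w v)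
    (u v w : V) : T u v w = 0 := by
  refine self_eq_neg.1 ?_
  calc T u v w = T v u w := hsymm u v w
    _ = -T v w u := hskew v u w
    _ = -T w v u := by rw [hsymm v w u]
    _ = T w u v := by rw [hskew w v u, neg_neg]
    _ = T u w v := hsymm w u v
    _ = -T u v w := hskew u w v

theorem eq_zero_of_skew_of_eq_smul_of_ne {ι V R : Type*} [Fintype ι] [DecidableEq ι] [CommRing R]
    [IsAddTorsionFree R] {c A : ι → V → R} {E : ι → V}
    (hE : ∀ i j, c i (E j) = if i = j then 1 else 0)
    (hskew : ∀ v w, ∑ i, (A i v * c i w + A i w * c i v) = 0) {k : ι}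
    (hA : ∀ i ≠ k, ∃ r : R, ∀ v, A i v = r * c i v) (i : ι) (v : V) : A i v = 0 := by
  have hpair : ∀ w j, A j w + ∑ i, A i (E j) * c i w = 0 := fun w j => by
    simpa [Finset.sum_add_distrib, hE] using hskew w (E j)
  have hdiag : ∀ j, A j (E j) = 0 := fun j =>
    self_eq_neg.1 (eq_neg_of_add_eq_zero_left (by simpa [hE] using hpair (E j) j))
  have hne : ∀ j ≠ k, ∀ w, A j w = 0 := fun j hj w => by
    obtain ⟨r, hr⟩ := hA j hj
    have hr0 : r = 0 := by simpa [hE, hr] using hdiag j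
    rw [hr, hr0, zero_mul]
  obtain rfl | hi := eq_or_ne i k
  · have hsum : ∑ j, A j (E i) * c j v = 0 := Finset.sum_eq_zero fun j _ => by
      obtain rfl | hj := eq_or_ne j i
      · rw [hdiag, zero_mul]
      · rw [hne j hj, zero_mul]
    simpa [hsum] using hpair v i
  · exact hne i hi v

theorem apply_mul_det {ι V R : Type*} [Fintype ι] [DecidableEq ι] [CommRing R] {h : V → V → R}
    {c : ι → V → R} (hc : ∀ v w, h v w = ∑ i, c i v * c i w) (b : ι → V) (k : ι) (v : V) :
    c k v * (Matrix.of fun i j => c i (b j)).det =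
      ((Matrix.of fun i j => c i (b j)).updateRow k fun j => h v (b j)).det := by
  set C : Matrix ι ι R := Matrix.of fun i j => c i (b j) with hC
  have hmul : Cᵀ.mulVec (fun i => c i v) = fun j => h v (b j) := by
    ext j
    simp only [hC, hc, Matrix.mulVec, dotProduct, Matrix.transpose_apply, Matrix.of_apply, mul_comm]
  rw [← Matrix.cramer_transpose_apply, ← hmul, Matrix.cramer_eq_adjugate_mulVec,
    Matrix.mulVec_mulVec, Matrix.adjugate_mul, Matrix.det_transpose, Matrix.smul_mulVec,
    Matrix.one_mulVec, Pi.smul_apply, smul_eq_mul, mul_comm]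

theorem det_gram_eq_det_sq {ι V R : Type*} [Fintype ι] [DecidableEq ι] [CommRing R] {h : V → V → R}
    {c : ι → V → R} (hc : ∀ v w, h v w = ∑ i, c i v * c i w) (b : ι → V) :
    (Matrix.of fun i j => h (b i) (b j)).det = (Matrix.of fun i j => c i (b j)).det ^ 2 := by
  have hmul : (Matrix.of fun i j => h (b i) (b j)) =
      (Matrix.of fun i j => c i (b j))ᵀ * Matrix.of fun i j => c i (b j) := by
    ext i j
    simp only [hc, Matrix.mul_apply, Matrix.transpose_apply, Matrix.of_apply]
  rw [hmul, Matrix.det_mul, Matrix.det_transpose, sq]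

theorem apply_eq_det_div_sqrt {ι V : Type*} [Fintype ι] [DecidableEq ι] {h : V → V → ℝ}
    {c : ι → V → ℝ} (hc : ∀ v w, h v w = ∑ i, c i v * c i w) {b : ι → V}
    (hb : 0 < (Matrix.of fun i j => c i (b j)).det) (k : ι) (v : V) :
    c k v = ((Matrix.of fun i j => c i (b j)).updateRow k fun j => h v (b j)).det /
      √(Matrix.of fun i j => h (b i) (b j)).det := by
  rw [det_gram_eq_det_sq hc, Real.sqrt_sq hb.le, eq_div_iff hb.ne', apply_mul_det hc]

theorem sum_mul_self_pos_of_det_ne_zero {ι V : Type*} [Fintype ι] [DecidableEq ι]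
    [AddCommGroup V] [Module ℝ V] (b : Module.Basis ι ℝ V) {c : ι → V →ₗ[ℝ] ℝ}
    (hb : (Matrix.of fun i j => c i (b j)).det ≠ 0) {v : V} (hv : v ≠ 0) :
    0 < ∑ i, c i v * c i v := by
  refine (Finset.sum_nonneg fun i _ => mul_self_nonneg _).lt_of_ne' fun hsum => hv ?_
  have hcv : ∀ i, c i v = 0 := fun i =>
    mul_self_eq_zero.1 ((Finset.sum_eq_zero_iff_of_nonneg fun i _ => mul_self_nonneg _).1 hsum i
      (Finset.mem_univ i))
  have hmul : (Matrix.of fun i j => c i (b j)).mulVec (b.repr v) = 0 := by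
    ext i
    rw [Pi.zero_apply, ← hcv i]
    conv_rhs => rw [← b.sum_repr v]
    simp only [Matrix.mulVec, dotProduct, Matrix.of_apply, map_sum, map_smul, smul_eq_mul, mul_comm]
  exact b.repr.map_eq_zero_iff.1 (DFunLike.coe_injective (Matrix.eq_zero_of_mulVec_eq_zero hb hmul))

end LinearAlgebra

section Sharp

theorem injective_of_pos {V : Type*} [AddCommGroup V] [Module ℝ V] [TopologicalSpace V]
    {h : V →L[ℝ] V →L[ℝ] ℝ} (hpos : ∀ v, v ≠ 0 → 0 < h v v) : Function.Injective h :=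
  (injective_iff_map_eq_zero h).2 fun v hv => by
    by_contra hne
    exact (hpos v hne).ne' (by rw [hv, zero_apply])

variable {V : Type*} [AddCommGroup V] [Module ℝ V] [TopologicalSpace V] [IsTopologicalAddGroup V]
  [ContinuousConstSMul ℝ V] {h : V →L[ℝ] V →L[ℝ] ℝ}

theorem sharp_eq (hh : Function.Injective h) {α : V →L[ℝ] ℝ} {a : V} (ha : ∀ w, h a w = α w) :
    sharp h α = a := by
  have hex : ∃ a : V, ∀ w : V, h a w = α w := ⟨a, ha⟩
  rw [sharp, dif_pos hex]
  exact hh (ContinuousLinearMap.ext fun w => (hex.choose_spec w).trans (ha w).symm)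

variable [FiniteDimensional ℝ V]

theorem sharp_apply (hh : Function.Injective h) (α : V →L[ℝ] ℝ) (w : V) :
    h (sharp h α) w = α w := by
  have hinj : Function.Injective (ContinuousLinearMap.coeLM ℝ ∘ₗ h.toLinearMap) :=
    ContinuousLinearMap.coe_injective.comp hh
  obtain ⟨a, ha⟩ := (LinearMap.injective_iff_surjective_of_finrank_eq_finrank
    Subspace.dual_finrank_eq.symm).1 hinj α.toLinearMap
  have ha' : ∀ w, h a w = α w := fun w => congrArg (fun f : Module.Dual ℝ V => f w) ha
  rw [sharp_eq hh ha', ha']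

theorem sharp_smul (hh : Function.Injective h) (r : ℝ) (α : V →L[ℝ] ℝ) :
    sharp h (r • α) = r • sharp h α :=
  sharp_eq hh fun w => by simp only [map_smul, smul_apply, sharp_apply hh]

variable {ι : Type*} [Fintype ι] {c : ι → V →L[ℝ] ℝ}

theorem sum_apply_smul_sharp (hh : Function.Injective h)
    (hc : ∀ v w, h v w = ∑ i, c i v * c i w) (v : V) : ∑ i, c i v • sharp h (c i) = v :=
  hh (ContinuousLinearMap.ext fun w => by
    simp only [map_sum, map_smul, sum_apply, smul_apply, sharp_apply hh, smul_eq_mul, hc])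

theorem apply_sharp_of_orthonormal [DecidableEq ι] (hV : Module.finrank ℝ V = Fintype.card ι)
    (hh : Function.Injective h) (hc : ∀ v w, h v w = ∑ i, c i v * c i w) (i j : ι) :
    c i (sharp h (c j)) = if i = j then 1 else 0 := by
  let L : V →ₗ[ℝ] ι → ℝ := LinearMap.pi fun i => (c i).toLinearMap
  have hL : ∀ v i, L v i = c i v := fun v i => rfl
  have hinj : Function.Injective L := fun v w hvw => hh (ContinuousLinearMap.ext fun z => by
    simp only [hc, ← hL, hvw])
  obtain ⟨a, ha⟩ := (LinearMap.injective_iff_surjective_of_finrank_eq_finrank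
    (hV.trans (Module.finrank_fintype_fun_eq_card ℝ).symm)).1 hinj (Pi.single j 1)
  have ha' : ∀ i, c i a = if i = j then 1 else 0 := fun i => by
    rw [← hL, ha, Pi.single_apply]
  rw [sharp_eq hh (a := a) fun w => by simp [hc, ha'], ha']

theorem sum_apply_sharp_mul (hh : Function.Injective h)
    (hc : ∀ v w, h v w = ∑ i, c i v * c i w) {f : V → ℝ} (hf : IsLinearMap ℝ f) (v : V) :
    ∑ i, f (sharp h (c i)) * c i v = f v := by
  calc ∑ i, f (sharp h (c i)) * c i v = hf.mk' f (∑ i, c i v • sharp h (c i)) := by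
        simp only [map_sum, map_smul, IsLinearMap.mk'_apply, smul_eq_mul, mul_comm]
    _ = f v := by rw [sum_apply_smul_sharp hh hc, IsLinearMap.mk'_apply]

end Sharp

section Orthonormal

theorem apply_eq_repr_of_orthonormal {ι V : Type*} [DecidableEq ι] [AddCommGroup V] [Module ℝ V]
    {h : V →ₗ[ℝ] V →ₗ[ℝ] ℝ} {B : Module.Basis ι ℝ V}
    (hB : ∀ i j, h (B i) (B j) = if i = j then 1 else 0) (i : ι) (v : V) :
    h (B i) v = B.repr v i := by
  have hcoord : h (B i) = B.coord i := B.ext fun j => by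
    rw [hB, B.coord_apply, B.repr_self, Finsupp.single_apply]
    simp only [eq_comm]
  rw [hcoord, B.coord_apply]

variable {ι V : Type*} [Fintype ι] [DecidableEq ι] [AddCommGroup V] [Module ℝ V]
  {h : V →ₗ[ℝ] V →ₗ[ℝ] ℝ}

theorem exists_orthonormal_basis_extension (hV : Module.finrank ℝ V = Fintype.card ι)
    (hsymm : ∀ v w, h v w = h w v) (hpos : ∀ v, v ≠ 0 → 0 < h v v) {k : ι} {E : ι → V}
    (hE : ∀ i ≠ k, ∀ j ≠ k, h (E i) (E j) = if i = j then 1 else 0) :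
    ∃ B : Module.Basis ι ℝ V, (∀ i ≠ k, B i = E i) ∧
      ∀ i j, h (B i) (B j) = if i = j then 1 else 0 := by
  have : Nonempty ι := ⟨k⟩
  have : FiniteDimensional ℝ V := Module.finite_of_finrank_pos (hV ▸ Fintype.card_pos)
  let core : InnerProductSpace.Core ℝ V :=
    { inner := fun v w => h v w
      conj_inner_symm := fun v w => hsymm w v
      re_inner_nonneg := fun v => by
        obtain rfl | hv := eq_or_ne v 0
        · simp
        · exact (hpos v hv).le
      add_left := fun u v w => by simp
      smul_left := fun v w r => by simp
      definite := fun v hv => by_contra fun hne => (hpos v hne).ne' hv }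
  let _ := core.toNormedAddCommGroup
  let _ := InnerProductSpace.ofCore core.toCore
  have hinner : ∀ v w, inner ℝ v w = h v w := fun v w => rfl
  obtain ⟨B, hB⟩ := Orthonormal.exists_orthonormalBasis_extension_of_card_eq hV (v := E)
    (s := {k}ᶜ) (orthonormal_iff_ite.2 fun i j => by
      simpa [hinner, Subtype.ext_iff] using hE i i.2 j j.2)
  exact ⟨B.toBasis, fun i hi => (congrFun B.coe_toBasis i).trans (hB i hi), fun i j => by
    rw [B.coe_toBasis, ← hinner, B.inner_eq_ite]⟩

theorem exists_orthonormal_basis_orientation_eq (o : Orientation ℝ V ι) (B : Module.Basis ι ℝ V)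
    (hB : ∀ i j, h (B i) (B j) = if i = j then 1 else 0) (k : ι) :
    ∃ B' : Module.Basis ι ℝ V, B'.orientation = o ∧ (∀ i ≠ k, B' i = B i) ∧
      ∀ i j, h (B' i) (B' j) = if i = j then 1 else 0 := by
  obtain ho | ho := B.orientation_eq_or_eq_neg o
  · exact ⟨B, ho.symm, fun i _ => rfl, hB⟩
  · refine ⟨B.unitsSMul (Function.update 1 k (-1)), (B.orientation_neg_single k).trans ho.symm,
      fun i hi => by simp [Module.Basis.unitsSMul_apply, hi], fun i j => ?_⟩
    simp only [Module.Basis.unitsSMul_apply, Units.smul_def, map_smul, LinearMap.smul_apply, hB,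
      smul_eq_mul]
    obtain rfl | hij := eq_or_ne i j
    · obtain rfl | hi := eq_or_ne i k
      · simp
      · simp [hi]
    · simp [hij]

theorem exists_oriented_orthonormal_basis_extension (hV : Module.finrank ℝ V = Fintype.card ι)
    (o : Orientation ℝ V ι) (hsymm : ∀ v w, h v w = h w v) (hpos : ∀ v, v ≠ 0 → 0 < h v v)
    {k : ι} {E : ι → V} (hE : ∀ i ≠ k, ∀ j ≠ k, h (E i) (E j) = if i = j then 1 else 0) :
    ∃ B : Module.Basis ι ℝ V, B.orientation = o ∧ (∀ i ≠ k, B i = E i) ∧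
      ∀ i j, h (B i) (B j) = if i = j then 1 else 0 := by
  obtain ⟨B, hBE, hB⟩ := exists_orthonormal_basis_extension hV hsymm hpos hE
  obtain ⟨B', ho, hB'B, hB'⟩ := exists_orthonormal_basis_orientation_eq o B hB k
  exact ⟨B', ho, fun i hi => (hB'B i hi).trans (hBE i hi), hB'⟩

theorem apply_eq_sum_of_orthonormal {B : Module.Basis ι ℝ V}
    (hB : ∀ i j, h (B i) (B j) = if i = j then 1 else 0) (v w : V) :
    h v w = ∑ i, h (B i) v * h (B i) w := by
  conv_lhs => rw [← B.sum_repr v]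
  simp only [map_sum, map_smul, LinearMap.sum_apply, LinearMap.smul_apply, smul_eq_mul,
    apply_eq_repr_of_orthonormal hB]

theorem det_apply_pos_of_orientation_eq {B b : Module.Basis ι ℝ V}
    (hB : ∀ i j, h (B i) (B j) = if i = j then 1 else 0) (hb : b.orientation = B.orientation) :
    0 < (Matrix.of fun i j => h (B i) (b j)).det := by
  have hmatrix : (Matrix.of fun i j => h (B i) (b j)) = B.toMatrix b := by
    ext i j
    rw [Matrix.of_apply, apply_eq_repr_of_orthonormal hB, Module.Basis.toMatrix_apply]
  rw [hmatrix, ← Module.Basis.det_apply]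
  exact (Module.Basis.orientation_eq_iff_det_pos B b).1 hb.symm

end Orthonormal

section Smoothness

variable {E F H M : Type*} [NormedAddCommGroup E] [NormedSpace ℝ E] [NormedAddCommGroup F]
  [NormedSpace ℝ F] [TopologicalSpace H] [TopologicalSpace M] [ChartedSpace H M]
  {I : ModelWithCorners ℝ E H} {n : WithTop ℕ∞} {p : M}

theorem contMDiffAt_clm_of_apply {V : Type*} [NormedAddCommGroup V] [NormedSpace ℝ V]
    [FiniteDimensional ℝ V] {f : M → V →L[ℝ] F}
    (hf : ∀ v, ContMDiffAt I 𝓘(ℝ, F) n (fun q => f q v) p) :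
    ContMDiffAt I 𝓘(ℝ, V →L[ℝ] F) n f p := by
  let e₁ := ContinuousLinearEquiv.ofFinrankEq
    (Module.finrank_fin_fun ℝ (n := Module.finrank ℝ V)).symm
  let e₂ := (e₁.arrowCongr (1 : F ≃L[ℝ] F)).trans (ContinuousLinearEquiv.piRing _)
  rw [← Function.id_comp f, ← e₂.symm_comp_self]
  exact e₂.symm.contDiff.contMDiff.contMDiffAt.comp p (contMDiffAt_pi_space.2 fun i => hf _)

theorem contMDiffAt_matrix_det {ι : Type*} [Fintype ι] [DecidableEq ι] {A : M → Matrix ι ι ℝ}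
    (hA : ∀ i j, ContMDiffAt I 𝓘(ℝ, ℝ) n (fun q => A q i j) p) :
    ContMDiffAt I 𝓘(ℝ, ℝ) n (fun q => (A q).det) p := by
  simp only [Matrix.det_apply']
  exact contMDiffAt_finsetSum fun σ _ =>
    contMDiffAt_const.mul (contMDiffAt_finsetProd fun i _ => hA (σ i) i)

end Smoothness

section LocalFrames

variable {S : Type*} [TopologicalSpace S] [ChartedSpace E3 S]

instance finiteDimensional_tangentSpace (x : S) : FiniteDimensional ℝ (TangentSpace (𝓡 3) x) :=
  inferInstanceAs (FiniteDimensional ℝ E3)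

theorem finrank_tangentSpace (x : S) :
    Module.finrank ℝ (TangentSpace (𝓡 3) x) = Fintype.card (Fin 3) :=
  finrank_euclideanSpace

variable [IsManifold (𝓡 3) ∞ S]

theorem differentiableAt_comp_extChartAt_symm {f : S → ℝ} {x : S}
    (hf : MDifferentiableAt (𝓡 3) 𝓘(ℝ, ℝ) f x) :
    DifferentiableAt ℝ (f ∘ (extChartAt (𝓡 3) x).symm) (extChartAt (𝓡 3) x x) := by
  have hchart : MDifferentiableAt 𝓘(ℝ, E3) (𝓡 3) (extChartAt (𝓡 3) x).symm
      (extChartAt (𝓡 3) x x) :=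
    ((contMDiffOn_extChartAt_symm (n := 1) x).contMDiffAt
      (extChartAt_target_mem_nhds x)).mdifferentiableAt one_ne_zero
  exact (MDifferentiableAt.comp_of_eq _ hf hchart (extChartAt_to_inv x)).differentiableAt

theorem mvfderiv_eq_fderiv_extChartAt_symm {f : S → ℝ} {x : S}
    (hf : MDifferentiableAt (𝓡 3) 𝓘(ℝ, ℝ) f x) (v : TangentSpace (𝓡 3) x) :
    mvfderiv (𝓡 3) f x v =
      fderiv ℝ (f ∘ (extChartAt (𝓡 3) x).symm) (extChartAt (𝓡 3) x x) (coordVec x v) := by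
  have hlocal : f =ᶠ[𝓝 x] (f ∘ (extChartAt (𝓡 3) x).symm) ∘ extChartAt (𝓡 3) x := by
    filter_upwards [extChartAt_source_mem_nhds (I := 𝓡 3) x] with y hy
    exact (congrArg f ((extChartAt (𝓡 3) x).left_inv hy)).symm
  have hcomp : mfderiv (𝓡 3) 𝓘(ℝ, ℝ) f x =
      (mfderiv 𝓘(ℝ, E3) 𝓘(ℝ, ℝ) (f ∘ (extChartAt (𝓡 3) x).symm) (extChartAt (𝓡 3) x x)).comp
        (mfderiv (𝓡 3) 𝓘(ℝ, E3) (extChartAt (𝓡 3) x) x) := by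
    rw [hlocal.mfderiv_eq]
    exact mfderiv_comp x (differentiableAt_comp_extChartAt_symm hf).mdifferentiableAt
      (mdifferentiableAt_extChartAt (mem_chart_source E3 x))
  rw [mfderiv_eq_fderiv] at hcomp
  exact congrArg (fun L => L v) hcomp

/-- The vector at `y` whose components in the trivialization of the tangent bundle given by the
preferred chart at `x₀` are `a`: for constant `a` these are local frames near `x₀`, on which
smoothness of tensor families is tested. It is `0` for `y` outside the chart. -/
def frameVec (x₀ y : S) : E3 →L[ℝ] TangentSpace (𝓡 3) y :=
  (trivializationAt E3 (TangentSpace (𝓡 3)) x₀).symmL ℝ y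

theorem smoothOneFormFamily_iff {α : ℝ → OneFormField S} :
    SmoothOneFormFamily α ↔ ∀ (p₀ : ℝ × S) (a : E3),
      ContMDiffAt (𝓘(ℝ, ℝ).prod (𝓡 3)) 𝓘(ℝ, ℝ) ∞
        (fun p : ℝ × S => α p.1 p.2 (frameVec p₀.2 p.2 a)) p₀ := by
  refine forall_congr' fun p₀ => ?_
  have hcoord : ∀ (p : ℝ × S) (a : E3),
      ContinuousLinearMap.inCoordinates E3 (TangentSpace (𝓡 3)) ℝ (Bundle.Trivial S ℝ)
        p₀.2 p.2 p₀.2 p.2 (α p.1 p.2) a = α p.1 p.2 (frameVec p₀.2 p.2 a) := fun p a => by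
    simp [ContinuousLinearMap.inCoordinates, frameVec]
  rw [contMDiffAt_hom_bundle, and_iff_right contMDiffAt_snd]
  constructor
  · intro hα a
    simpa only [hcoord] using hα.clm_apply (contMDiffAt_const (c := a))
  · intro hα
    refine contMDiffAt_clm_of_apply fun a => ?_
    simpa only [hcoord] using hα a

theorem inCoordinates_apply_frameVec (B : BilinField S) {x₀ y : S}
    (hy : y ∈ (trivializationAt E3 (TangentSpace (𝓡 3)) x₀).baseSet) (a b : E3) :
    ContinuousLinearMap.inCoordinates E3 (TangentSpace (𝓡 3)) (E3 →L[ℝ] ℝ)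
      (fun x : S => TangentSpace (𝓡 3) x →L[ℝ] Bundle.Trivial S ℝ x) x₀ y x₀ y (B y) a b =
      B y (frameVec x₀ y a) (frameVec x₀ y b) := by
  rw [inCoordinates_apply_eq₂ hy hy (Set.mem_univ _)]
  simp [frameVec, Trivialization.symmL_apply _ hy]

theorem smoothBilinFamily_iff {h : ℝ → BilinField S} :
    SmoothBilinFamily h ↔ ∀ (p₀ : ℝ × S) (a b : E3),
      ContMDiffAt (𝓘(ℝ, ℝ).prod (𝓡 3)) 𝓘(ℝ, ℝ) ∞
        (fun p : ℝ × S => h p.1 p.2 (frameVec p₀.2 p.2 a) (frameVec p₀.2 p.2 b)) p₀ := by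
  refine forall_congr' fun p₀ => ?_
  have hbase : ∀ᶠ p : ℝ × S in 𝓝 p₀,
      p.2 ∈ (trivializationAt E3 (TangentSpace (𝓡 3)) p₀.2).baseSet :=
    continuousAt_snd.eventually
      ((trivializationAt E3 (TangentSpace (𝓡 3)) p₀.2).open_baseSet.mem_nhds
        (mem_baseSet_trivializationAt E3 (TangentSpace (𝓡 3)) p₀.2))
  rw [contMDiffAt_hom_bundle, and_iff_right contMDiffAt_snd]
  constructor
  · intro hh a b
    refine ((hh.clm_apply (contMDiffAt_const (c := a))).clm_apply
      (contMDiffAt_const (c := b))).congr_of_eventuallyEq (hbase.mono fun p hp => ?_)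
    exact (inCoordinates_apply_frameVec (h p.1) hp a b).symm
  · intro hh
    refine contMDiffAt_clm_of_apply fun a => contMDiffAt_clm_of_apply fun b =>
      (hh a b).congr_of_eventuallyEq (hbase.mono fun p hp => ?_)
    exact inCoordinates_apply_frameVec (h p.1) hp a b

theorem frameVec_coordVec (x : S) (v : TangentSpace (𝓡 3) x) :
    frameVec x x (coordVec x v) = v := by
  unfold frameVec coordVec
  rw [← TangentBundle.continuousLinearMapAt_trivializationAt (mem_chart_source E3 x)]
  exact Trivialization.symmL_continuousLinearMapAt _
    (mem_baseSet_trivializationAt E3 (TangentSpace (𝓡 3)) x) v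

theorem formInChart_eq_apply_frameVec (α : OneFormField S) {x : S} {z : E3}
    (hz : z ∈ (extChartAt (𝓡 3) x).target) (a : E3) :
    formInChart α x z a =
      α ((extChartAt (𝓡 3) x).symm z) (frameVec x ((extChartAt (𝓡 3) x).symm z) a) := by
  have hy : (extChartAt (𝓡 3) x).symm z ∈ (chartAt E3 x).source := by
    simpa only [extChartAt_source] using (extChartAt (𝓡 3) x).map_target hz
  rw [frameVec, TangentBundle.symmL_trivializationAt hy, ModelWithCorners.range_eq_univ,
    mfderivWithin_univ, (extChartAt (𝓡 3) x).right_inv hz]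
  rfl

theorem formInChart_coordVec (α : OneFormField S) (x : S) (w : TangentSpace (𝓡 3) x) :
    formInChart α x (extChartAt (𝓡 3) x x) (coordVec x w) = α x w := by
  rw [formInChart_eq_apply_frameVec α (mem_extChartAt_target x), extChartAt_to_inv,
    frameVec_coordVec]

/-- Differentiability at `x` of the components of the one-form `α` in the preferred chart
at `x`. -/
def FormDifferentiableAt (α : OneFormField S) (x : S) : Prop :=
  ∀ a, DifferentiableAt ℝ (fun z => formInChart α x z a) (extChartAt (𝓡 3) x x)

theorem SmoothOneFormFamily.formDifferentiableAt {α : ℝ → OneFormField S}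
    (hα : SmoothOneFormFamily α) (t : ℝ) (x : S) : FormDifferentiableAt (α t) x := fun a => by
  have hchart : ContMDiffAt 𝓘(ℝ, E3) (𝓘(ℝ, ℝ).prod (𝓡 3)) ∞
      (fun z : E3 => ((t, (extChartAt (𝓡 3) x).symm z) : ℝ × S)) (extChartAt (𝓡 3) x x) :=
    contMDiffAt_const.prodMk
      ((contMDiffOn_extChartAt_symm x).contMDiffAt (extChartAt_target_mem_nhds x))
  have hcomp := ContMDiffAt.comp_of_eq (smoothOneFormFamily_iff.1 hα (t, x) a) hchart
    (by rw [extChartAt_to_inv])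
  refine (hcomp.contDiffAt.differentiableAt (by simp)).congr_of_eventuallyEq ?_
  filter_upwards [extChartAt_target_mem_nhds (I := 𝓡 3) x] with z hz
  exact formInChart_eq_apply_frameVec (α t) hz a

theorem SmoothOneFormFamily.contDiff_apply {α : ℝ → OneFormField S} (hα : SmoothOneFormFamily α)
    (x : S) (v : TangentSpace (𝓡 3) x) : ContDiff ℝ ∞ fun s => α s x v := by
  refine contDiff_iff_contDiffAt.2 fun t => ?_
  have htime : ContMDiffAt 𝓘(ℝ, ℝ) (𝓘(ℝ, ℝ).prod (𝓡 3)) ∞ (fun s : ℝ => ((s, x) : ℝ × S)) t :=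
    contMDiffAt_id.prodMk contMDiffAt_const
  have hcomp := (smoothOneFormFamily_iff.1 hα (t, x) (coordVec x v)).comp t htime
  simpa only [Function.comp_def, frameVec_coordVec] using hcomp.contDiffAt

theorem SmoothOneFormFamily.differentiable_apply {α : ℝ → OneFormField S}
    (hα : SmoothOneFormFamily α) (x : S) (v : TangentSpace (𝓡 3) x) :
    Differentiable ℝ fun s => α s x v :=
  (hα.contDiff_apply x v).differentiable (by simp)

end LocalFrames

section LeviCivita

variable {S : Type*} [TopologicalSpace S] [ChartedSpace E3 S] {h : BilinField S} {x : S}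

theorem IsRiemannian.injective (hh : IsRiemannian h) (x : S) : Function.Injective (h x) :=
  injective_of_pos (hh.pos x)

theorem bilinInChart_comm (hsymm : ∀ x v w, h x v w = h x w v) (x : S) (z a b : E3) :
    bilinInChart h x z a b = bilinInChart h x z b a :=
  hsymm _ _ _

theorem christoffel_comm (hsymm : ∀ x v w, h x v w = h x w v) (x : S) (c a b : E3) :
    christoffel h x c a b = christoffel h x c b a := by
  simp only [christoffel, bilinInChart_comm hsymm x _ a b]
  ring

theorem christoffel_add_christoffel (hsymm : ∀ x v w, h x v w = h x w v) (x : S) (c a b : E3) :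
    christoffel h x c a b + christoffel h x b a c =
      fderiv ℝ (fun z => bilinInChart h x z b c) (extChartAt (𝓡 3) x x) a := by
  simp only [christoffel, bilinInChart_comm hsymm x _ c b]
  ring

theorem extDerivOneForm_eq_covDeriv_sub_covDeriv (hsymm : ∀ x v w, h x v w = h x w v)
    (α : OneFormField S) (x : S) (v w : TangentSpace (𝓡 3) x) :
    extDerivOneForm α x v w = covDeriv h α x v w - covDeriv h α x w v := by
  simp only [extDerivOneForm, covDeriv, christoffel_comm hsymm x _ (coordVec x w)]
  ring

/-- Differentiability at `x` of the components of the bilinear form `h` in the preferred chart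
at `x`. -/
def BilinDifferentiableAt (h : BilinField S) (x : S) : Prop :=
  ∀ a b, DifferentiableAt ℝ (fun z => bilinInChart h x z a b) (extChartAt (𝓡 3) x x)

theorem isLinearMap_bilinInChart (h : BilinField S) (x : S) (z a : E3) :
    IsLinearMap ℝ fun b => bilinInChart h x z a b :=
  ((h _ (mfderiv 𝓘(ℝ, E3) (𝓡 3) (extChartAt (𝓡 3) x).symm z a)).comp
    (mfderiv 𝓘(ℝ, E3) (𝓡 3) (extChartAt (𝓡 3) x).symm z)).toLinearMap.isLinear

theorem isLinearMap_fderiv_bilinInChart (hd : BilinDifferentiableAt h x) (a c : E3) :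
    IsLinearMap ℝ fun b => fderiv ℝ (fun z => bilinInChart h x z a b) (extChartAt (𝓡 3) x x) c where
  map_add b b' := by
    simp only [(isLinearMap_bilinInChart h x _ a).map_add]
    rw [fderiv_fun_add (hd a b) (hd a b'), add_apply]
  map_smul r b := by
    simp only [(isLinearMap_bilinInChart h x _ a).map_smul]
    rw [fderiv_fun_const_smul (hd a b), smul_apply]

theorem isLinearMap_christoffel (hd : BilinDifferentiableAt h x) (a b : E3) :
    IsLinearMap ℝ fun v : TangentSpace (𝓡 3) x => christoffel h x (coordVec x v) a b where
  map_add v w := by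
    have hvw : coordVec x (v + w) = coordVec x v + coordVec x w := map_add _ v w
    simp only [christoffel, hvw, (isLinearMap_fderiv_bilinInChart hd _ _).map_add, map_add]
    ring
  map_smul r v := by
    have hrv : coordVec x (r • v) = r • coordVec x v := map_smul _ r v
    simp only [christoffel, hrv, (isLinearMap_fderiv_bilinInChart hd _ _).map_smul, map_smul,
      smul_eq_mul]
    ring

/-- The metric `h` is the sum of the squares of the one-forms `c i`. -/
def IsOrthonormalCoframe {ι : Type*} [Fintype ι] (h : BilinField S) (c : ι → OneFormField S) :
    Prop :=
  ∀ x v w, h x v w = ∑ i, c i x v * c i x w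

namespace IsOrthonormalCoframe

variable {ι : Type*} [Fintype ι] {c : ι → OneFormField S}

theorem bilinInChart_eq (hc : IsOrthonormalCoframe h c) (x : S) (z a b : E3) :
    bilinInChart h x z a b = ∑ i, formInChart (c i) x z a * formInChart (c i) x z b :=
  hc _ _ _

theorem bilinDifferentiableAt (hc : IsOrthonormalCoframe h c)
    (hd : ∀ i, FormDifferentiableAt (c i) x) : BilinDifferentiableAt h x := fun a b => by
  simp only [hc.bilinInChart_eq]
  exact DifferentiableAt.fun_sum fun i _ => (hd i a).mul (hd i b)

variable [IsManifold (𝓡 3) ∞ S]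

theorem fderiv_bilinInChart (hc : IsOrthonormalCoframe h c)
    (hd : ∀ i, FormDifferentiableAt (c i) x) (a : E3) (v w : TangentSpace (𝓡 3) x) :
    fderiv ℝ (fun z => bilinInChart h x z (coordVec x v) (coordVec x w))
        (extChartAt (𝓡 3) x x) a =
      ∑ i,
        (fderiv ℝ (fun z => formInChart (c i) x z (coordVec x v)) (extChartAt (𝓡 3) x x) a *
            c i x w +
          fderiv ℝ (fun z => formInChart (c i) x z (coordVec x w)) (extChartAt (𝓡 3) x x) a *
            c i x v) := by
  simp only [hc.bilinInChart_eq]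
  rw [fderiv_fun_sum fun i _ => (hd i _).fun_mul (hd i _), sum_apply]
  refine Finset.sum_congr rfl fun i _ => ?_
  rw [fderiv_fun_mul (hd i _) (hd i _)]
  simp only [formInChart_coordVec, add_apply, smul_apply, smul_eq_mul]
  ring

theorem covDeriv_skew (hc : IsOrthonormalCoframe h c) (hh : IsRiemannian h)
    (hd : ∀ i, FormDifferentiableAt (c i) x) (v w z : TangentSpace (𝓡 3) x) :
    ∑ i, (covDeriv h (c i) x v w * c i x z + covDeriv h (c i) x v z * c i x w) = 0 := by
  have hΓ : ∀ w z : TangentSpace (𝓡 3) x,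
      ∑ i, christoffel h x (coordVec x (sharp (h x) (c i x))) (coordVec x v) (coordVec x w) *
        c i x z = christoffel h x (coordVec x z) (coordVec x v) (coordVec x w) := fun w z =>
    sum_apply_sharp_mul (hh.injective x) (hc x)
      (isLinearMap_christoffel (hc.bilinDifferentiableAt hd) _ _) z
  have hmetric :=
    christoffel_add_christoffel hh.symm x (coordVec x z) (coordVec x v) (coordVec x w)
  rw [hc.fderiv_bilinInChart hd, ← hΓ w z, ← hΓ z w, Finset.sum_add_distrib] at hmetric
  simp only [covDeriv, sub_mul, Finset.sum_add_distrib, Finset.sum_sub_distrib]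
  linarith

end IsOrthonormalCoframe

variable [IsManifold (𝓡 3) ∞ S]

theorem covDeriv_smul (hh : Function.Injective (h x)) (hdh : BilinDifferentiableAt h x)
    {f : S → ℝ} (hf : MDifferentiableAt (𝓡 3) 𝓘(ℝ, ℝ) f x) {α : OneFormField S}
    (hdα : FormDifferentiableAt α x) (v w : TangentSpace (𝓡 3) x) :
    covDeriv h (fun y => f y • α y) x v w =
      mvfderiv (𝓡 3) f x v * α x w + f x * covDeriv h α x v w := by
  have hchart : ∀ z a, formInChart (fun y => f y • α y) x z a =
      (f ∘ (extChartAt (𝓡 3) x).symm) z * formInChart α x z a := fun z a => rfl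
  simp only [covDeriv, hchart]
  rw [fderiv_fun_mul (differentiableAt_comp_extChartAt_symm hf) (hdα _), sharp_smul hh,
    (isLinearMap_christoffel hdh _ _).map_smul, mvfderiv_eq_fderiv_extChartAt_symm hf,
    ← formInChart_coordVec α x w]
  simp only [add_apply, smul_apply, smul_eq_mul, Function.comp_apply, extChartAt_to_inv]
  ring

end LeviCivita

section Shape

variable {S : Type*} [TopologicalSpace S] [ChartedSpace E3 S] {lapse : ℝ → S → ℝ}
  {h : ℝ → BilinField S} {t : ℝ} {x : S}

theorem shape_comm (hsymm : ∀ t x v w, h t x v w = h t x w v) (v w : TangentSpace (𝓡 3) x) :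
    shape lapse h t x v w = shape lapse h t x w v := by
  simp only [shape, hsymm _ x v w]

theorem isLinearMap_shape (hd : ∀ v w, DifferentiableAt ℝ (fun s => h s x v w) t)
    (w : TangentSpace (𝓡 3) x) : IsLinearMap ℝ fun v => shape lapse h t x v w where
  map_add v v' := by
    simp only [shape, map_add, add_apply]
    rw [deriv_fun_add (hd v w) (hd v' w), mul_add]
  map_smul r v := by
    simp only [shape, map_smul, smul_apply, smul_eq_mul]
    rw [deriv_const_mul r (hd v w)]
    ring

theorem shapeForm_smul (hh : Function.Injective (h t x))
    (hd : ∀ v w, DifferentiableAt ℝ (fun s => h s x v w) t) (f : S → ℝ) (α : OneFormField S)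
    (w : TangentSpace (𝓡 3) x) :
    shapeForm lapse h t (fun y => f y • α y) x w = f x * shapeForm lapse h t α x w := by
  simp only [shapeForm, sharp_smul hh, (isLinearMap_shape hd w).map_smul, smul_eq_mul]

end Shape

section CoframeFamilies

variable {S : Type*} [TopologicalSpace S] [ChartedSpace E3 S] {e : Fin 3 → ℝ → OneFormField S}
  {t : ℝ} {x : S}

theorem coframeMetric_apply (e : Fin 3 → ℝ → OneFormField S) (t : ℝ) (x : S)
    (v w : TangentSpace (𝓡 3) x) : coframeMetric e t x v w = ∑ i, e i t x v * e i t x w := by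
  simp only [coframeMetric, sum_apply, ContinuousLinearMap.smulRight_apply, smul_apply,
    smul_eq_mul]

theorem isOrthonormalCoframe_coframeMetric (e : Fin 3 → ℝ → OneFormField S) (t : ℝ) :
    IsOrthonormalCoframe (coframeMetric e t) fun i => e i t :=
  coframeMetric_apply e t

theorem coframeMetric_comm (e : Fin 3 → ℝ → OneFormField S) (t : ℝ) (x : S)
    (v w : TangentSpace (𝓡 3) x) : coframeMetric e t x v w = coframeMetric e t x w v := by
  simp only [coframeMetric_apply, mul_comm]

/-- `Θ_t = - ½ ∂_t h_{e^t}`. -/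
abbrev coframeShape (e : Fin 3 → ℝ → OneFormField S) (t : ℝ) (x : S)
    (v w : TangentSpace (𝓡 3) x) : ℝ :=
  shape (fun _ _ => 1) (coframeMetric e) t x v w

theorem coframeShape_comm (v w : TangentSpace (𝓡 3) x) :
    coframeShape e t x v w = coframeShape e t x w v :=
  shape_comm (coframeMetric_comm e) v w

/-- The left-hand side of the evolution equation `∂_t e_i + Θ_t(e_i) = 0`. -/
def evolutionDefect (e : Fin 3 → ℝ → OneFormField S) (i : Fin 3) (t : ℝ) (x : S)
    (v : TangentSpace (𝓡 3) x) : ℝ :=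
  deriv (fun s => e i s x v) t + coframeShapeForm e t (e i t) x v

/-- The tensor `∇e_i - Θ_t(e_i) ⊗ e_u`, to which `Θ_t` is added for `i = u`. It is skew in the
pair formed by `i` and the second slot, and its antisymmetrization in the two slots is the defect
of the structure equation `de_i = Θ_t(e_i) ∧ e_u`. -/
def structureDefect (e : Fin 3 → ℝ → OneFormField S) (i : Fin 3) (t : ℝ) (x : S)
    (v w : TangentSpace (𝓡 3) x) : ℝ :=
  covDeriv (coframeMetric e t) (e i t) x v w - coframeShapeForm e t (e i t) x v * e 0 t x w +
    if i = 0 then coframeShape e t x v w else 0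

theorem structureDefect_sub_structureDefect (i : Fin 3) (v w : TangentSpace (𝓡 3) x) :
    structureDefect e i t x v w - structureDefect e i t x w v =
      extDerivOneForm (e i t) x v w -
        (coframeShapeForm e t (e i t) x v * e 0 t x w -
          coframeShapeForm e t (e i t) x w * e 0 t x v) := by
  rw [extDerivOneForm_eq_covDeriv_sub_covDeriv (coframeMetric_comm e t), structureDefect,
    structureDefect, coframeShape_comm w v]
  ring

variable [IsManifold (𝓡 3) ∞ S]

/-- A smooth family of coframes, without reference to an orientation: three smooth families of
one-forms which are linearly independent at every point, that is, for which `h_{e^t}` is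
Riemannian. -/
structure IsCoframeFamily (e : Fin 3 → ℝ → OneFormField S) : Prop where
  smooth : ∀ i, SmoothOneFormFamily (e i)
  isRiemannian : ∀ t, IsRiemannian (coframeMetric e t)

namespace IsCoframeFamily

theorem injective (he : IsCoframeFamily e) (t : ℝ) (x : S) :
    Function.Injective (coframeMetric e t x) :=
  (he.isRiemannian t).injective x

theorem smoothBilinFamily (he : IsCoframeFamily e) : SmoothBilinFamily (coframeMetric e) := by
  refine smoothBilinFamily_iff.2 fun p₀ a b => ?_
  simp only [coframeMetric_apply]
  exact ContMDiffAt.sum fun i _ => (smoothOneFormFamily_iff.1 (he.smooth i) p₀ a).mul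
    (smoothOneFormFamily_iff.1 (he.smooth i) p₀ b)

theorem bilinDifferentiableAt (he : IsCoframeFamily e) (t : ℝ) (x : S) :
    BilinDifferentiableAt (coframeMetric e t) x :=
  (isOrthonormalCoframe_coframeMetric e t).bilinDifferentiableAt fun i =>
    (he.smooth i).formDifferentiableAt t x

theorem differentiableAt_coframeMetric (he : IsCoframeFamily e) (t : ℝ) (x : S)
    (v w : TangentSpace (𝓡 3) x) :
    DifferentiableAt ℝ (fun s => coframeMetric e s x v w) t := by
  simp only [coframeMetric_apply]
  exact DifferentiableAt.fun_sum fun i _ => ((he.smooth i).differentiable_apply x v t).mul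
    ((he.smooth i).differentiable_apply x w t)

theorem apply_sharp (he : IsCoframeFamily e) (t : ℝ) (x : S) (i j : Fin 3) :
    e i t x (sharp (coframeMetric e t x) (e j t x)) = if i = j then 1 else 0 :=
  apply_sharp_of_orthonormal (c := fun i => e i t x) (finrank_tangentSpace x) (he.injective t x)
    (coframeMetric_apply e t x) i j

theorem coframeShape_eq (he : IsCoframeFamily e) (v w : TangentSpace (𝓡 3) x) :
    coframeShape e t x v w = -(1 / 2) *
      ∑ i, (deriv (fun s => e i s x v) t * e i t x w +
        e i t x v * deriv (fun s => e i s x w) t) := by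
  have hd : ∀ i v, DifferentiableAt ℝ (fun s => e i s x v) t := fun i v =>
    (he.smooth i).differentiable_apply x v t
  simp only [coframeShape, shape, coframeMetric_apply, mul_one]
  rw [deriv_fun_sum fun i _ => (hd i v).fun_mul (hd i w)]
  exact congrArg _ (Finset.sum_congr rfl fun i _ => deriv_fun_mul (hd i v) (hd i w))

theorem sum_coframeShapeForm_mul (he : IsCoframeFamily e) (v w : TangentSpace (𝓡 3) x) :
    ∑ i, coframeShapeForm e t (e i t) x v * e i t x w = coframeShape e t x w v :=
  sum_apply_sharp_mul (c := fun i => e i t x) (he.injective t x) (coframeMetric_apply e t x)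
    (isLinearMap_shape (lapse := fun _ _ => 1) (he.differentiableAt_coframeMetric t x) v) w

theorem evolutionDefect_skew (he : IsCoframeFamily e) (v w : TangentSpace (𝓡 3) x) :
    ∑ i, (evolutionDefect e i t x v * e i t x w + evolutionDefect e i t x w * e i t x v) = 0 := by
  have hΘ := he.coframeShape_eq (t := t) v w
  simp only [evolutionDefect, add_mul, Finset.sum_add_distrib, he.sum_coframeShapeForm_mul,
    coframeShape_comm w v, mul_comm (e _ t x v)] at hΘ ⊢
  linarith

theorem structureDefect_skew (he : IsCoframeFamily e) (v w z : TangentSpace (𝓡 3) x) :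
    ∑ i, (structureDefect e i t x v w * e i t x z + structureDefect e i t x v z * e i t x w) =
      0 := by
  have h0 : ∀ w z : TangentSpace (𝓡 3) x,
      ∑ i, structureDefect e i t x v w * e i t x z =
        ∑ i, covDeriv (coframeMetric e t) (e i t) x v w * e i t x z -
          coframeShape e t x v z * e 0 t x w + coframeShape e t x v w * e 0 t x z := fun w z => by
    rw [coframeShape_comm v z, ← he.sum_coframeShapeForm_mul v z, Finset.sum_mul]
    simp only [structureDefect, add_mul, sub_mul, ite_mul, zero_mul, Finset.sum_add_distrib,
      Finset.sum_sub_distrib, Finset.sum_ite_eq', Finset.mem_univ, if_true, mul_right_comm]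
  have hmetric := (isOrthonormalCoframe_coframeMetric e t).covDeriv_skew (he.isRiemannian t)
    (fun i => (he.smooth i).formDifferentiableAt t x) v w z
  rw [Finset.sum_add_distrib] at hmetric ⊢
  rw [h0, h0]
  linarith

theorem eq_zero_of_skew (he : IsCoframeFamily e) {A : Fin 3 → TangentSpace (𝓡 3) x → ℝ}
    (hskew : ∀ v w, ∑ i, (A i v * e i t x w + A i w * e i t x v) = 0)
    (hA0 : ∃ r, ∀ v, A 0 v = r * e 0 t x v) (hA1 : ∀ v, A 1 v = 0) (i : Fin 3)
    (v : TangentSpace (𝓡 3) x) : A i v = 0 :=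
  eq_zero_of_skew_of_eq_smul_of_ne (c := fun i => e i t x) (k := 2) (he.apply_sharp t x) hskew
    (fun i hi => by
      fin_cases i
      · exact hA0
      · exact ⟨0, fun v => (hA1 v).trans (zero_mul _).symm⟩
      · exact absurd rfl hi) i v

theorem structureDefect_eq_zero (he : IsCoframeFamily e)
    (hsymm : ∀ i v w, structureDefect e i t x v w = structureDefect e i t x w v) (i : Fin 3)
    (v w : TangentSpace (𝓡 3) x) : structureDefect e i t x v w = 0 := by
  have hzero : ∀ v w z : TangentSpace (𝓡 3) x,
      ∑ i, structureDefect e i t x v w * e i t x z = 0 :=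
    eq_zero_of_symm_of_skew (fun v w z => by simp only [hsymm _ v w]) fun v w z =>
      eq_neg_of_add_eq_zero_left (Finset.sum_add_distrib.symm.trans (he.structureDefect_skew v w z))
  simpa only [he.apply_sharp, mul_ite, mul_one, mul_zero, Finset.sum_ite_eq', Finset.mem_univ,
    if_true] using hzero v w (sharp (coframeMetric e t x) (e i t x))

end IsCoframeFamily

end CoframeFamilies

section FunctionFamilies

theorem mvfderiv_comp_of_hasDerivAt {E H M : Type*} [NormedAddCommGroup E] [NormedSpace ℝ E]
    [TopologicalSpace H] {I : ModelWithCorners ℝ E H} [TopologicalSpace M] [ChartedSpace H M]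
    {f : M → ℝ} {φ : ℝ → ℝ} {φ' : ℝ} {x : M} (hφ : HasDerivAt φ φ' (f x))
    (hf : MDifferentiableAt I 𝓘(ℝ, ℝ) f x) (v : TangentSpace I x) :
    mvfderiv I (fun y => φ (f y)) x v = φ' * mvfderiv I f x v := by
  have hderiv : ∀ r : ℝ, mvfderiv 𝓘(ℝ, ℝ) φ (f x) r = φ' * r := fun r => by
    rw [mvfderiv, mfderiv_eq_fderiv, hφ.hasFDerivAt.fderiv]
    exact mul_comm r φ'
  exact (mvfderiv_comp_apply x hφ.differentiableAt.mdifferentiableAt hf v).trans (hderiv _)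

variable {S : Type*} [TopologicalSpace S] [ChartedSpace E3 S] {f : ℝ → S → ℝ}

theorem SmoothFunctionFamily.contMDiff (hf : SmoothFunctionFamily f) (t : ℝ) :
    ContMDiff (𝓡 3) 𝓘(ℝ, ℝ) ∞ (f t) :=
  ContMDiff.comp (g := fun p : ℝ × S => f p.1 p.2) hf (contMDiff_const.prodMk contMDiff_id)

theorem SmoothFunctionFamily.differentiable (hf : SmoothFunctionFamily f) (x : S) :
    Differentiable ℝ fun t => f t x := by
  have htime : ContMDiff 𝓘(ℝ, ℝ) 𝓘(ℝ, ℝ) ∞ fun t => f t x :=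
    ContMDiff.comp (g := fun p : ℝ × S => f p.1 p.2) hf (contMDiff_id.prodMk contMDiff_const)
  exact htime.contDiff.differentiable (by simp)

theorem SmoothFunctionFamily.smul [IsManifold (𝓡 3) ∞ S] (hf : SmoothFunctionFamily f)
    {α : ℝ → OneFormField S} (hα : SmoothOneFormFamily α) :
    SmoothOneFormFamily fun t x => f t x • α t x :=
  smoothOneFormFamily_iff.2 fun p₀ a => (hf p₀).mul (smoothOneFormFamily_iff.1 hα p₀ a)

end FunctionFamilies

section FlowToCoframe

variable {S : Type*} [TopologicalSpace S] [ChartedSpace E3 S] [IsManifold (𝓡 3) ∞ S]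
  {F : ParallelSpinorFlow S} {e : Fin 3 → ℝ → OneFormField S}

theorem ParallelSpinorFlow.IsComoving.lapse_eq (hF : F.IsComoving) : F.lapse = fun _ _ => 1 :=
  funext₂ hF

namespace IsAdapted

theorem metric_eq (ha : IsAdapted F e) : F.h = coframeMetric e :=
  funext ha.metric

theorem u_eq_smul (ha : IsAdapted F e) : F.u = fun t x => F.u0 t x • e 0 t x :=
  funext₂ ha.u_eq

theorem l_eq_coframe (ha : IsAdapted F e) : F.l = e 1 :=
  funext₂ ha.l_eq

theorem deriv_u0_mul_add (ha : IsAdapted F e) (hF : F.IsComoving) (he : IsCoframeFamily e) (t : ℝ)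
    (x : S) (v : TangentSpace (𝓡 3) x) :
    deriv (fun s => F.u0 s x) t * e 0 t x v + F.u0 t x * evolutionDefect e 0 t x v = 0 := by
  have hu := F.evolution_u t x v
  simp only [hF.lapse_eq, ha.metric_eq, ha.u_eq_smul, smul_apply, smul_eq_mul, mvfderiv_const,
    zero_apply, mul_zero, one_mul] at hu
  rw [shapeForm_smul (he.injective t x) (he.differentiableAt_coframeMetric t x), deriv_fun_mul
    (F.smooth_u0.differentiable x t) ((he.smooth 0).differentiable_apply x v t)] at hu
  rw [evolutionDefect, coframeShapeForm]
  linarith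

theorem evolutionDefect_one (ha : IsAdapted F e) (hF : F.IsComoving) (t : ℝ) (x : S)
    (v : TangentSpace (𝓡 3) x) : evolutionDefect e 1 t x v = 0 := by
  have hl := F.evolution_l t x v
  simp only [hF.lapse_eq, ha.metric_eq, ha.l_eq_coframe, mvfderiv_const, zero_apply, zero_mul,
    add_zero, one_mul, ← mul_add] at hl
  exact (mul_eq_zero.1 hl).resolve_left (F.u0_ne_zero t x)

theorem evolutionDefect_eq_zero (ha : IsAdapted F e) (hF : F.IsComoving) (he : IsCoframeFamily e)
    (i : Fin 3) (t : ℝ) (x : S) (v : TangentSpace (𝓡 3) x) : evolutionDefect e i t x v = 0 := by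
  refine he.eq_zero_of_skew he.evolutionDefect_skew
    ⟨-(deriv (fun s => F.u0 s x) t / F.u0 t x), fun v => ?_⟩ (ha.evolutionDefect_one hF t x) i v
  have hu := ha.deriv_u0_mul_add hF he t x v
  field_simp [F.u0_ne_zero t x]
  linarith

theorem u0_eq (ha : IsAdapted F e) (hF : F.IsComoving) (he : IsCoframeFamily e) (s t : ℝ) :
    F.u0 s = F.u0 t := by
  funext x
  refine is_const_of_deriv_eq_zero (F.smooth_u0.differentiable x) (fun r => ?_) s t
  simpa only [ha.evolutionDefect_eq_zero hF he, he.apply_sharp, if_true, mul_one, mul_zero,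
    add_zero] using ha.deriv_u0_mul_add hF he r x (sharp (coframeMetric e r x) (e 0 r x))

theorem mvfderiv_u0_mul_add (ha : IsAdapted F e) (hF : F.IsComoving) (he : IsCoframeFamily e)
    (t : ℝ) (x : S) (v w : TangentSpace (𝓡 3) x) :
    (mvfderiv (𝓡 3) (F.u0 t) x v + F.u0 t x * coframeShapeForm e t (e 0 t) x v) * e 0 t x w +
      F.u0 t x * structureDefect e 0 t x v w = 0 := by
  have hu := F.constraint_u t x v w
  simp only [hF.lapse_eq, ha.metric_eq, ha.u_eq_smul] at hu
  rw [covDeriv_smul (he.injective t x) (he.bilinDifferentiableAt t x)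
    ((F.smooth_u0.contMDiff t x).mdifferentiableAt (by simp))
    ((he.smooth 0).formDifferentiableAt t x)] at hu
  rw [structureDefect, if_pos rfl, coframeShape]
  linarith

theorem structureDefect_one (ha : IsAdapted F e) (hF : F.IsComoving) (t : ℝ) (x : S)
    (v w : TangentSpace (𝓡 3) x) : structureDefect e 1 t x v w = 0 := by
  have hl := F.constraint_l t x v w
  simp only [hF.lapse_eq, ha.metric_eq, ha.l_eq_coframe, ha.u_eq_smul, smul_apply, smul_eq_mul,
    mul_left_comm _ (F.u0 t x)] at hl
  rw [structureDefect, if_neg one_ne_zero, add_zero, coframeShapeForm,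
    mul_left_cancel₀ (F.u0_ne_zero t x) hl, sub_self]

theorem structureDefect_eq_zero (ha : IsAdapted F e) (hF : F.IsComoving) (he : IsCoframeFamily e)
    (i : Fin 3) (t : ℝ) (x : S) (v w : TangentSpace (𝓡 3) x) :
    structureDefect e i t x v w = 0 := by
  refine he.eq_zero_of_skew (he.structureDefect_skew v) ⟨-((mvfderiv (𝓡 3) (F.u0 t) x v +
    F.u0 t x * coframeShapeForm e t (e 0 t) x v) / F.u0 t x), fun w => ?_⟩
    (ha.structureDefect_one hF t x v) i w
  have hu := ha.mvfderiv_u0_mul_add hF he t x v w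
  field_simp [F.u0_ne_zero t x]
  linarith

theorem mvfderiv_u0 (ha : IsAdapted F e) (hF : F.IsComoving) (he : IsCoframeFamily e) (t : ℝ)
    (x : S) (v : TangentSpace (𝓡 3) x) :
    mvfderiv (𝓡 3) (F.u0 t) x v = -(F.u0 t x * coframeShapeForm e t (e 0 t) x v) := by
  refine eq_neg_of_add_eq_zero_left ?_
  simpa only [ha.structureDefect_eq_zero hF he, he.apply_sharp, if_true, mul_one, mul_zero,
    add_zero] using ha.mvfderiv_u0_mul_add hF he t x v (sharp (coframeMetric e t x) (e 0 t x))

theorem coframeShapeForm_eq (ha : IsAdapted F e) (hF : F.IsComoving) (he : IsCoframeFamily e)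
    (t : ℝ) (x : S) (v : TangentSpace (𝓡 3) x) :
    coframeShapeForm e t (e 0 t) x v = mvfderiv (𝓡 3) (fun y => -Real.log (F.u0 0 y)) x v := by
  rw [mvfderiv_comp_of_hasDerivAt (Real.hasDerivAt_log (F.u0_ne_zero 0 x)).fun_neg
    ((F.smooth_u0.contMDiff 0 x).mdifferentiableAt (by simp)), ha.u0_eq hF he 0 t,
    ha.mvfderiv_u0 hF he, neg_mul_neg, inv_mul_cancel_left₀ (F.u0_ne_zero t x)]

theorem comovingFlowEquations (ha : IsAdapted F e) (hF : F.IsComoving) (he : IsCoframeFamily e) :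
    ComovingFlowEquations e where
  evolution i t x v := ha.evolutionDefect_eq_zero hF he i t x v
  structure_eq i t x v w := by
    have hdefect := structureDefect_sub_structureDefect (e := e) (t := t) i v w
    rw [ha.structureDefect_eq_zero hF he, ha.structureDefect_eq_zero hF he, sub_zero] at hdefect
    exact sub_eq_zero.1 hdefect.symm
  exact t := by
    refine ⟨fun x => -Real.log (F.u0 0 x), fun x => ?_, fun x v =>
      (ha.coframeShapeForm_eq hF he t x v).symm⟩
    exact ContMDiffAt.comp (g := fun r => -Real.log r) x
      (Real.contDiffAt_log.2 (F.u0_ne_zero 0 x)).neg.contMDiffAt (F.smooth_u0.contMDiff 0 x)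
  stationary t x v := by
    simp only [ha.coframeShapeForm_eq hF he, deriv_const]

end IsAdapted

end FlowToCoframe

section Potentials

variable {S : Type*} [TopologicalSpace S] [ChartedSpace E3 S] {f : S → ℝ}

theorem smoothFunctionFamily_exp_neg (hf : ContMDiff (𝓡 3) 𝓘(ℝ, ℝ) ∞ f) :
    SmoothFunctionFamily fun _ x => Real.exp (-f x) :=
  ContMDiff.comp (g := fun r => Real.exp (-r)) (Real.contDiff_exp.comp contDiff_neg).contMDiff
    (hf.comp contMDiff_snd)

theorem mvfderiv_exp_neg (hf : ContMDiff (𝓡 3) 𝓘(ℝ, ℝ) ∞ f) (x : S)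
    (v : TangentSpace (𝓡 3) x) :
    mvfderiv (𝓡 3) (fun y => Real.exp (-f y)) x v = -Real.exp (-f x) * mvfderiv (𝓡 3) f x v := by
  rw [mvfderiv_comp_of_hasDerivAt (φ := fun r => Real.exp (-r)) (hasDerivAt_neg (f x)).exp
    ((hf x).mdifferentiableAt (by simp)), mul_neg_one]

end Potentials

section CoframeToFlow

variable {S : Type*} [TopologicalSpace S] [ChartedSpace E3 S] [IsManifold (𝓡 3) ∞ S]
  {e : Fin 3 → ℝ → OneFormField S}

namespace ComovingFlowEquations

theorem structureDefect_eq_zero (hc : ComovingFlowEquations e) (he : IsCoframeFamily e)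
    (i : Fin 3) (t : ℝ) (x : S) (v w : TangentSpace (𝓡 3) x) :
    structureDefect e i t x v w = 0 :=
  he.structureDefect_eq_zero (fun i v w => sub_eq_zero.1
    ((structureDefect_sub_structureDefect i v w).trans
      (sub_eq_zero.2 (hc.structure_eq i t x v w)))) i v w

theorem coframeShapeForm_eq (hc : ComovingFlowEquations e) (he : ∀ i, SmoothOneFormFamily (e i))
    (s t : ℝ) (x : S) (v : TangentSpace (𝓡 3) x) :
    coframeShapeForm e s (e 0 s) x v = coframeShapeForm e t (e 0 t) x v := by
  have hΘ : (fun s => coframeShapeForm e s (e 0 s) x v) = fun s => -deriv (fun r => e 0 r x v) s :=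
    funext fun s => eq_neg_of_add_eq_zero_right (hc.evolution 0 s x v)
  have hd : Differentiable ℝ fun s => coframeShapeForm e s (e 0 s) x v := by
    rw [hΘ]
    exact ((contDiff_infty_iff_deriv.1 ((he 0).contDiff_apply x v)).2.differentiable
      (by simp)).fun_neg
  exact is_const_of_deriv_eq_zero hd (fun r => hc.stationary r x v) s t

/-- The comoving flow with `h_t = h_{e^t}`, `u^⊥ = u⁰ e_u` and `l^⊥ = e_l`, where `u⁰ = exp(-f)`
for a potential `f` of the one-forms `Θ_t(e_u)`. -/
def flowOfPotential (hc : ComovingFlowEquations e) (he : IsCoframeFamily e) {f : S → ℝ}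
    (hf : ContMDiff (𝓡 3) 𝓘(ℝ, ℝ) ∞ f)
    (hdf : ∀ t x v, mvfderiv (𝓡 3) f x v = coframeShapeForm e t (e 0 t) x v) :
    ParallelSpinorFlow S where
  lapse _ _ := 1
  h := coframeMetric e
  u0 _ x := Real.exp (-f x)
  u t x := Real.exp (-f x) • e 0 t x
  l := e 1
  smooth_lapse := contMDiff_const
  smooth_h := he.smoothBilinFamily
  smooth_u0 := smoothFunctionFamily_exp_neg hf
  smooth_u := (smoothFunctionFamily_exp_neg hf).smul (he.smooth 0)
  smooth_l := he.smooth 1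
  lapse_ne_zero _ _ := one_ne_zero
  riemannian := he.isRiemannian
  u0_ne_zero _ _ := Real.exp_ne_zero _
  evolution_u t x v := by
    rw [shapeForm_smul (he.injective t x) (he.differentiableAt_coframeMetric t x)]
    simp only [smul_apply, smul_eq_mul, mvfderiv_const, zero_apply, mul_zero, one_mul]
    rw [deriv_const_mul _ ((he.smooth 0).differentiable_apply x v t), ← mul_add]
    exact mul_eq_zero_of_right _ (hc.evolution 0 t x v)
  evolution_l t x v := by
    simp only [mvfderiv_const, zero_apply, zero_mul, add_zero, one_mul, ← mul_add]
    exact mul_eq_zero_of_right _ (hc.evolution 1 t x v)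
  constraint_u t x v w := by
    have hdefect := hc.structureDefect_eq_zero he 0 t x v w
    rw [structureDefect, if_pos rfl, coframeShape] at hdefect
    rw [covDeriv_smul (he.injective t x) (he.bilinDifferentiableAt t x)
      ((smoothFunctionFamily_exp_neg hf).contMDiff t x |>.mdifferentiableAt (by simp))
      ((he.smooth 0).formDifferentiableAt t x), mvfderiv_exp_neg hf, hdf t]
    linear_combination Real.exp (-f x) * hdefect
  constraint_l t x v w := by
    have hdefect := hc.structureDefect_eq_zero he 1 t x v w
    rw [structureDefect, if_neg one_ne_zero, coframeShapeForm] at hdefect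
    rw [smul_apply, smul_eq_mul]
    linear_combination Real.exp (-f x) * hdefect
  norm_u t x := by
    rw [formInner, sharp_smul (he.injective t x), map_smul, smul_apply, he.apply_sharp, if_pos rfl,
      smul_eq_mul, smul_eq_mul, mul_one, sq]
  norm_l t x := he.apply_sharp t x 1 1
  orthogonal t x := by
    rw [formInner, smul_apply, he.apply_sharp, if_neg zero_ne_one, smul_zero]

theorem exists_flow (hc : ComovingFlowEquations e) (he : IsCoframeFamily e) :
    ∃ F : ParallelSpinorFlow S, F.IsComoving ∧ IsAdapted F e := by
  obtain ⟨f, hf, hdf⟩ := hc.exact 0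
  have hdf' : ∀ t x v, mvfderiv (𝓡 3) f x v = coframeShapeForm e t (e 0 t) x v := fun t x v =>
    (hdf x v).trans (hc.coframeShapeForm_eq he.smooth 0 t x v)
  exact ⟨hc.flowOfPotential he hf hdf', fun _ _ => rfl, fun _ => rfl, fun _ _ => rfl,
    fun _ _ => rfl⟩

end ComovingFlowEquations

end CoframeToFlow

section AdaptedCoframes

theorem exists_oriented_orthonormal_coframe_extension {ι V : Type*} [Fintype ι] [DecidableEq ι]
    [AddCommGroup V] [Module ℝ V] [TopologicalSpace V] [IsTopologicalAddGroup V]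
    [ContinuousConstSMul ℝ V] [FiniteDimensional ℝ V] (hV : Module.finrank ℝ V = Fintype.card ι)
    (o : Orientation ℝ V ι) {h : V →L[ℝ] V →L[ℝ] ℝ} (hsymm : ∀ v w, h v w = h w v)
    (hpos : ∀ v, v ≠ 0 → 0 < h v v) {k : ι} {a : ι → V →L[ℝ] ℝ}
    (ha : ∀ i ≠ k, ∀ j ≠ k, a i (sharp h (a j)) = if i = j then 1 else 0) :
    ∃ c : ι → V →L[ℝ] ℝ, (∀ i ≠ k, c i = a i) ∧ (∀ v w, h v w = ∑ i, c i v * c i w) ∧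
      ∀ b : Module.Basis ι ℝ V, b.orientation = o → 0 < (Matrix.of fun i j => c i (b j)).det := by
  have hinj := injective_of_pos hpos
  let H : V →ₗ[ℝ] V →ₗ[ℝ] ℝ := ContinuousLinearMap.coeLM ℝ ∘ₗ h.toLinearMap
  obtain ⟨B, hBo, hBa, hB⟩ := exists_oriented_orthonormal_basis_extension (h := H) hV o hsymm hpos
    (k := k) (E := fun i => sharp h (a i)) fun i hi j hj =>
      (sharp_apply hinj (a i) _).trans (ha i hi j hj)
  refine ⟨fun i => h (B i), fun i hi => ?_, apply_eq_sum_of_orthonormal (h := H) hB, fun b hb =>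
    det_apply_pos_of_orientation_eq (h := H) hB (hb.trans hBo.symm)⟩
  exact (congrArg h (hBa i hi)).trans (ContinuousLinearMap.ext (sharp_apply hinj (a i)))

variable {S : Type*} [TopologicalSpace S] [ChartedSpace E3 S] [IsManifold (𝓡 3) ∞ S]
  {o : ManifoldOrientation S} {e : Fin 3 → ℝ → OneFormField S}

theorem exists_oriented_basis (o : ManifoldOrientation S) (x : S) :
    ∃ b : Module.Basis (Fin 3) ℝ (TangentSpace (𝓡 3) x), b.orientation = o.at' x :=
  ⟨(Module.finBasisOfFinrankEq ℝ _ (finrank_tangentSpace x)).adjustToOrientation (o.at' x),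
    Module.Basis.orientation_adjustToOrientation _ _⟩

theorem IsOrientedCoframeFamily.isCoframeFamily (he : IsOrientedCoframeFamily o e) :
    IsCoframeFamily e where
  smooth := he.smooth
  isRiemannian t :=
    { symm := coframeMetric_comm e t
      pos := fun x v hv => by
        obtain ⟨b, hb⟩ := exists_oriented_basis o x
        rw [coframeMetric_apply]
        exact sum_mul_self_pos_of_det_ne_zero b (c := fun i => (e i t x).toLinearMap)
          (he.oriented t x b hb).ne' hv }

theorem eventually_exists_oriented_basis_eq_frameVec (o : ManifoldOrientation S) (x₀ : S) :
    ∃ a : Fin 3 → E3, ∀ᶠ y in 𝓝 x₀, ∃ b : Module.Basis (Fin 3) ℝ (TangentSpace (𝓡 3) y),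
      b.orientation = o.at' y ∧ ∀ j, b j = frameVec x₀ y (a j) := by
  obtain ⟨b₀, hb₀⟩ := exists_oriented_basis o x₀
  let T := trivializationAt E3 (TangentSpace (𝓡 3)) x₀
  have hx₀ : x₀ ∈ T.baseSet := mem_baseSet_trivializationAt E3 (TangentSpace (𝓡 3)) x₀
  let a := b₀.map (T.continuousLinearEquivAt ℝ x₀ hx₀).toLinearEquiv
  refine ⟨a, ?_⟩
  filter_upwards [T.open_baseSet.mem_nhds hx₀, o.locally_constant x₀] with y hy ho
  refine ⟨a.map (T.continuousLinearEquivAt ℝ y hy).toLinearEquiv.symm, ?_, fun j => ?_⟩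
  · rw [Module.Basis.orientation_map, Module.Basis.orientation_map, hb₀, ← ho hy]
    exact (Orientation.map (Fin 3)
      (T.continuousLinearEquivAt ℝ y hy).toLinearEquiv).symm_apply_apply _
  · exact congrArg (fun L => L (a j)) (T.symm_continuousLinearEquivAt_eq (R := ℝ) hy)

/-- The coframes `e^t`, on which no smoothness is imposed, are oriented. -/
def IsPositivelyOriented (o : ManifoldOrientation S) (e : Fin 3 → ℝ → OneFormField S) : Prop :=
  ∀ t x (b : Module.Basis (Fin 3) ℝ (TangentSpace (𝓡 3) x)),
    b.orientation = o.at' x → 0 < (Matrix.of fun i j => e i t x (b j)).det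

namespace IsPositivelyOriented

theorem smoothOneFormFamily (ho : IsPositivelyOriented o e)
    (hh : SmoothBilinFamily (coframeMetric e)) {k : Fin 3}
    (he : ∀ i ≠ k, SmoothOneFormFamily (e i)) : SmoothOneFormFamily (e k) := by
  refine smoothOneFormFamily_iff.2 fun p₀ a => ?_
  obtain ⟨f, hf⟩ := eventually_exists_oriented_basis_eq_frameVec o p₀.2
  let b : Fin 3 → ∀ p : ℝ × S, TangentSpace (𝓡 3) p.2 := fun j p => frameVec p₀.2 p.2 (f j)
  have hdet : ∀ᶠ p : ℝ × S in 𝓝 p₀, 0 < (Matrix.of fun i j => e i p.1 p.2 (b j p)).det := by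
    filter_upwards [continuousAt_snd.eventually hf] with p ⟨b', hb', hbf⟩
    simpa only [hbf] using ho p.1 p.2 b' hb'
  have hrow : ContMDiffAt (𝓘(ℝ, ℝ).prod (𝓡 3)) 𝓘(ℝ, ℝ) ∞ (fun p : ℝ × S =>
      ((Matrix.of fun i j => e i p.1 p.2 (b j p)).updateRow k fun j =>
        coframeMetric e p.1 p.2 (frameVec p₀.2 p.2 a) (b j p)).det) p₀ := by
    refine contMDiffAt_matrix_det fun i j => ?_
    obtain rfl | hi := eq_or_ne i k
    · simpa only [Matrix.updateRow_self] using smoothBilinFamily_iff.1 hh p₀ a (f j)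
    · simpa only [Matrix.updateRow_ne hi, Matrix.of_apply] using
        smoothOneFormFamily_iff.1 (he i hi) p₀ (f j)
  have hgram : ContMDiffAt (𝓘(ℝ, ℝ).prod (𝓡 3)) 𝓘(ℝ, ℝ) ∞ (fun p : ℝ × S =>
      (Matrix.of fun i j => coframeMetric e p.1 p.2 (b i p) (b j p)).det) p₀ :=
    contMDiffAt_matrix_det fun i j => smoothBilinFamily_iff.1 hh p₀ (f i) (f j)
  have hgram_pos :
      0 < (Matrix.of fun i j => coframeMetric e p₀.1 p₀.2 (b i p₀) (b j p₀)).det := by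
    rw [det_gram_eq_det_sq (c := fun i => e i p₀.1 p₀.2) (coframeMetric_apply e p₀.1 p₀.2)]
    exact pow_pos hdet.self_of_nhds 2
  refine (hrow.div₀ ((Real.contDiffAt_sqrt hgram_pos.ne').contMDiffAt.comp p₀ hgram)
    (Real.sqrt_ne_zero'.2 hgram_pos)).congr_of_eventuallyEq ?_
  exact hdet.mono fun p hp => apply_eq_det_div_sqrt (c := fun i => e i p.1 p.2)
    (coframeMetric_apply e p.1 p.2) hp k _

theorem eq_of_coframeMetric_eq (ho : IsPositivelyOriented o e) {e' : Fin 3 → ℝ → OneFormField S}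
    (ho' : IsPositivelyOriented o e') (hmetric : coframeMetric e = coframeMetric e') {k : Fin 3}
    (he : ∀ i ≠ k, e i = e' i) : e = e' := by
  suffices hk : e k = e' k from funext fun i => by
    obtain rfl | hi := eq_or_ne i k
    exacts [hk, he i hi]
  funext t x
  ext v
  obtain ⟨b, hb⟩ := exists_oriented_basis o x
  rw [apply_eq_det_div_sqrt (c := fun i => e i t x) (coframeMetric_apply e t x) (ho t x b hb),
    apply_eq_det_div_sqrt (c := fun i => e' i t x) (coframeMetric_apply e' t x) (ho' t x b hb),
    hmetric]
  congr 2
  ext i j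
  obtain rfl | hi := eq_or_ne i k
  · simp only [Matrix.updateRow_self]
  · simp only [Matrix.updateRow_ne hi, Matrix.of_apply, he i hi]

end IsPositivelyOriented

theorem IsAdapted.unique {F : ParallelSpinorFlow S} {e' : Fin 3 → ℝ → OneFormField S}
    (ha : IsAdapted F e) (ho : IsPositivelyOriented o e) (ha' : IsAdapted F e')
    (ho' : IsPositivelyOriented o e') : e = e' := by
  refine ho.eq_of_coframeMetric_eq ho' (ha.metric_eq.symm.trans ha'.metric_eq) (k := 2)
    fun i hi => funext₂ fun t x => ?_
  fin_cases i
  · exact smul_right_injective _ (F.u0_ne_zero t x) ((ha.u_eq t x).symm.trans (ha'.u_eq t x))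
  · exact (ha.l_eq t x).symm.trans (ha'.l_eq t x)
  · exact absurd rfl hi

namespace ParallelSpinorFlow

theorem exists_isPositivelyOriented_isAdapted (F : ParallelSpinorFlow S)
    (o : ManifoldOrientation S) :
    ∃ e : Fin 3 → ℝ → OneFormField S, IsPositivelyOriented o e ∧ IsAdapted F e := by
  let a : ℝ → ∀ x : S, Fin 3 → TangentSpace (𝓡 3) x →L[ℝ] ℝ :=
    fun t x => ![(F.u0 t x)⁻¹ • F.u t x, F.l t x, 0]
  have ha : ∀ t x, ∀ i ≠ 2, ∀ j ≠ 2,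
      a t x i (sharp (F.h t x) (a t x j)) = if i = j then 1 else 0 := fun t x i hi j hj => by
    have hinj := (F.riemannian t).injective x
    have hlu : F.l t x (sharp (F.h t x) (F.u t x)) = 0 := by
      rw [← sharp_apply hinj, (F.riemannian t).symm, sharp_apply hinj]
      exact F.orthogonal t x
    have huu : (F.u0 t x)⁻¹ * ((F.u0 t x)⁻¹ * F.u t x (sharp (F.h t x) (F.u t x))) = 1 := by
      rw [show F.u t x (sharp (F.h t x) (F.u t x)) = F.u0 t x ^ 2 from (F.norm_u t x).symm, sq,
        inv_mul_cancel_left₀ (F.u0_ne_zero t x), inv_mul_cancel₀ (F.u0_ne_zero t x)]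
    have hul : F.u t x (sharp (F.h t x) (F.l t x)) = 0 := F.orthogonal t x
    have hll : F.l t x (sharp (F.h t x) (F.l t x)) = 1 := F.norm_l t x
    fin_cases i <;> fin_cases j <;> simp_all [a, sharp_smul hinj]
  choose c hca hmetric hdet using fun t x => exists_oriented_orthonormal_coframe_extension
    (finrank_tangentSpace x) (o.at' x) ((F.riemannian t).symm x) ((F.riemannian t).pos x) (ha t x)
  refine ⟨fun i t x => c t x i, hdet, fun t => ?_, fun t x => ?_, fun t x => ?_⟩
  · funext x
    ext v w
    rw [hmetric, coframeMetric_apply]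
  · rw [hca t x 0 (by decide)]
    exact (smul_inv_smul₀ (F.u0_ne_zero t x) _).symm
  · exact (hca t x 1 (by decide)).symm

theorem exists_isAdapted (F : ParallelSpinorFlow S)
    (o : ManifoldOrientation S) :
    ∃ e : Fin 3 → ℝ → OneFormField S, IsOrientedCoframeFamily o e ∧ IsAdapted F e := by
  obtain ⟨e, ho, ha⟩ := F.exists_isPositivelyOriented_isAdapted o
  have h0 : SmoothOneFormFamily (e 0) := by
    have he0 : e 0 = fun t x => (F.u0 t x)⁻¹ • F.u t x := funext₂ fun t x => by
      rw [ha.u_eq, inv_smul_smul₀ (F.u0_ne_zero t x)]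
    have hinv : SmoothFunctionFamily fun t x => (F.u0 t x)⁻¹ := fun p =>
      (F.smooth_u0 p).inv₀ (F.u0_ne_zero _ _)
    exact he0 ▸ hinv.smul F.smooth_u
  have h1 : SmoothOneFormFamily (e 1) := ha.l_eq_coframe ▸ F.smooth_l
  have h2 : SmoothOneFormFamily (e 2) :=
    ho.smoothOneFormFamily (ha.metric_eq ▸ F.smooth_h) fun i hi => by
      fin_cases i
      exacts [h0, h1, absurd rfl hi]
  exact ⟨e, ⟨fun i => by fin_cases i; exacts [h0, h1, h2], ho⟩, ha⟩

end ParallelSpinorFlow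

end AdaptedCoframes

section StandardMetrics

variable {S : Type*} [TopologicalSpace S] [ChartedSpace E3 S] {g : SpacetimeBilinField S}

theorem IsStandardMetric.unique {lapse : ℝ → S → ℝ} {h h' : ℝ → BilinField S}
    (hg : IsStandardMetric g lapse h) (hg' : IsStandardMetric g lapse h') : h = h' := by
  funext t x
  ext v w
  let i : TangentSpace (𝓡 3) x → TangentSpace (𝓘(ℝ, ℝ).prod (𝓡 3)) ((t, x) : ℝ × S) :=
    fun v => ((0 : ℝ), v)
  have hi : ∀ v, mfderiv (𝓘(ℝ, ℝ).prod (𝓡 3)) (𝓡 3) (Prod.snd : ℝ × S → S) (t, x) (i v) = v :=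
    fun v => by
      rw [mfderiv_snd]
      rfl
  have hspatial := add_left_cancel ((hg (t, x) (i v) (i w)).symm.trans (hg' (t, x) (i v) (i w)))
  rwa [hi, hi] at hspatial

variable [IsManifold (𝓡 3) ∞ S] {o : ManifoldOrientation S}

theorem IsAdapted.isStandardMetric_iff {F : ParallelSpinorFlow S} {e : Fin 3 → ℝ → OneFormField S}
    (ha : IsAdapted F e) (hF : F.IsComoving) :
    IsStandardMetric g F.lapse F.h ↔ IsStandardMetric g (fun _ _ => 1) (coframeMetric e) := by
  rw [hF.lapse_eq, ha.metric_eq]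

theorem admitsComovingParallelSpinorFlow_iff (o : ManifoldOrientation S)
    (g : SpacetimeBilinField S) :
    AdmitsComovingParallelSpinorFlow g ↔
      ∃ e : Fin 3 → ℝ → OneFormField S, IsOrientedCoframeFamily o e ∧ ComovingFlowEquations e ∧
        IsStandardMetric g (fun _ _ => 1) (coframeMetric e) := by
  constructor
  · rintro ⟨F, hF, hg⟩
    obtain ⟨e, he, ha⟩ := F.exists_isAdapted o
    exact ⟨e, he, ha.comovingFlowEquations hF he.isCoframeFamily,
      (ha.isStandardMetric_iff hF).1 hg⟩
  · rintro ⟨e, he, hc, hg⟩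
    obtain ⟨F, hF, ha⟩ := hc.exists_flow he.isCoframeFamily
    exact ⟨F, hF, (ha.isStandardMetric_iff hF).2 hg⟩

theorem isComovingGloballyHyperbolic_iff_complete {e : Fin 3 → ℝ → OneFormField S}
    (he : IsCoframeFamily e) (hg : IsStandardMetric g (fun _ _ => 1) (coframeMetric e)) :
    IsComovingGloballyHyperbolic g ↔ ∀ t, IsCompleteMetric (coframeMetric e t) := by
  constructor
  · rintro ⟨h, -, -, hcomplete, hh⟩
    exact hh.unique hg ▸ hcomplete
  · exact fun hcomplete =>
      ⟨coframeMetric e, he.smoothBilinFamily, he.isRiemannian, hcomplete, hg⟩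

theorem admitsComovingParallelSpinorFlow_and_isComovingGloballyHyperbolic_iff
    (o : ManifoldOrientation S) (g : SpacetimeBilinField S) :
    AdmitsComovingParallelSpinorFlow g ∧ IsComovingGloballyHyperbolic g ↔
      ∃ e : Fin 3 → ℝ → OneFormField S, IsOrientedCoframeFamily o e ∧ ComovingFlowEquations e ∧
        (∀ t, IsCompleteMetric (coframeMetric e t)) ∧
        IsStandardMetric g (fun _ _ => 1) (coframeMetric e) := by
  rw [admitsComovingParallelSpinorFlow_iff o]
  constructor
  · rintro ⟨⟨e, he, hc, hg⟩, hcomplete⟩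
    exact ⟨e, he, hc,
      (isComovingGloballyHyperbolic_iff_complete he.isCoframeFamily hg).1 hcomplete, hg⟩
  · rintro ⟨e, he, hc, hcomplete, hg⟩
    exact ⟨⟨e, he, hc, hg⟩,
      (isComovingGloballyHyperbolic_iff_complete he.isCoframeFamily hg).2 hcomplete⟩

theorem ParallelSpinorFlow.existsUnique_isAdapted (F : ParallelSpinorFlow S)
    (o : ManifoldOrientation S) :
    ∃! e : Fin 3 → ℝ → OneFormField S, IsOrientedCoframeFamily o e ∧ IsAdapted F e := by
  obtain ⟨e, he, ha⟩ := F.exists_isAdapted o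
  exact ⟨e, ⟨he, ha⟩, fun e' ⟨he', ha'⟩ => ha'.unique he'.oriented ha he.oriented⟩

end StandardMetrics

end ComovingSpinor

end

open ComovingSpinor in
theorem mainTheorem4_general {S : Type*} [TopologicalSpace S] [ChartedSpace E3 S]
    [IsManifold (𝓡 3) ∞ S] (o : ManifoldOrientation S) :
    (∀ g : SpacetimeBilinField S, AdmitsComovingParallelSpinorFlow g ↔
      ∃ e : Fin 3 → ℝ → OneFormField S, IsOrientedCoframeFamily o e ∧ ComovingFlowEquations e ∧
        IsStandardMetric g (fun _ _ => 1) (coframeMetric e)) ∧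
    (∀ g : SpacetimeBilinField S,
      (AdmitsComovingParallelSpinorFlow g ∧ IsComovingGloballyHyperbolic g) ↔
        ∃ e : Fin 3 → ℝ → OneFormField S, IsOrientedCoframeFamily o e ∧ ComovingFlowEquations e ∧
          (∀ t, IsCompleteMetric (coframeMetric e t)) ∧
          IsStandardMetric g (fun _ _ => 1) (coframeMetric e)) ∧
    (∀ F : ParallelSpinorFlow S, F.IsComoving →
      (∃! e : Fin 3 → ℝ → OneFormField S, IsOrientedCoframeFamily o e ∧ IsAdapted F e) ∧
      ∀ e : Fin 3 → ℝ → OneFormField S,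
        IsOrientedCoframeFamily o e → IsAdapted F e → ComovingFlowEquations e) ∧
    (∀ e : Fin 3 → ℝ → OneFormField S, IsOrientedCoframeFamily o e → ComovingFlowEquations e →
      ∃ F : ParallelSpinorFlow S, F.IsComoving ∧ IsAdapted F e) :=
  ⟨admitsComovingParallelSpinorFlow_iff o,
    admitsComovingParallelSpinorFlow_and_isComovingGloballyHyperbolic_iff o,
    fun F hF => ⟨F.existsUnique_isAdapted o,
      fun _ he ha => ha.comovingFlowEquations hF he.isCoframeFamily⟩,
    fun _ he hc => hc.exists_flow he.isCoframeFamily⟩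

theorem mainTheorem4 {S : Type*} [TopologicalSpace S] [T2Space S] [SecondCountableTopology S]
    [ChartedSpace ComovingSpinor.E3 S] [IsManifold (𝓡 3) ∞ S]
    (o : ComovingSpinor.ManifoldOrientation S) :
    -- the existence statement, for every metric `g` on `ℝ × S`
    (∀ g : ComovingSpinor.SpacetimeBilinField S,
      ComovingSpinor.AdmitsComovingParallelSpinorFlow g ↔
        ∃ e : Fin 3 → ℝ → ComovingSpinor.OneFormField S,
          ComovingSpinor.IsOrientedCoframeFamily o e ∧
          ComovingSpinor.ComovingFlowEquations e ∧
          ComovingSpinor.IsStandardMetric g (fun _ _ => 1) (ComovingSpinor.coframeMetric e)) ∧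
    -- the same with complete metrics `h_t`
    (∀ g : ComovingSpinor.SpacetimeBilinField S,
      (ComovingSpinor.AdmitsComovingParallelSpinorFlow g ∧
          ComovingSpinor.IsComovingGloballyHyperbolic g) ↔
        ∃ e : Fin 3 → ℝ → ComovingSpinor.OneFormField S,
          ComovingSpinor.IsOrientedCoframeFamily o e ∧
          ComovingSpinor.ComovingFlowEquations e ∧
          (∀ t, ComovingSpinor.IsCompleteMetric (ComovingSpinor.coframeMetric e t)) ∧
          ComovingSpinor.IsStandardMetric g (fun _ _ => 1) (ComovingSpinor.coframeMetric e)) ∧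
    -- a comoving flow determines its family of coframes, which solves the equations
    (∀ F : ComovingSpinor.ParallelSpinorFlow S, F.IsComoving →
      (∃! e : Fin 3 → ℝ → ComovingSpinor.OneFormField S,
        ComovingSpinor.IsOrientedCoframeFamily o e ∧ ComovingSpinor.IsAdapted F e) ∧
      ∀ e : Fin 3 → ℝ → ComovingSpinor.OneFormField S,
        ComovingSpinor.IsOrientedCoframeFamily o e → ComovingSpinor.IsAdapted F e →
          ComovingSpinor.ComovingFlowEquations e) ∧
    -- every solution comes from a comoving flow
    (∀ e : Fin 3 → ℝ → ComovingSpinor.OneFormField S,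
      ComovingSpinor.IsOrientedCoframeFamily o e → ComovingSpinor.ComovingFlowEquations e →
        ∃ F : ComovingSpinor.ParallelSpinorFlow S,
          F.IsComoving ∧ ComovingSpinor.IsAdapted F e) :=
  mainTheorem4_general o
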